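/- Let $G$ and $F$ be locally compact (Hausdorff) groups, let $\rho:F\to\mathrm{Aut}(G)$ be a homomorphism such that $(g,f)\mapsto\rho_f(g)$ is continuous on $G\times F$, and let $H=G\rtimes_\rho F$ be the topological semidirect product, with canonical injections $j_1:G\to H$, $j_2:F\to H$. Let $\mathcal A$ be a unital $C^*$-algebra and $\sigma:H\to\mathrm{Aut}^*(\mathcal A)$ a homomorphism such that $h\mapsto\sigma(h)a$ is norm continuous for every $a\in\mathcal A$. Assume that $\sigma$ is inner, implemented by a group homomorphism $v:H\to\mathcal U(\mathcal A)$, that is, $\sigma(h)(a)=v(h)\,a\,v(h)^{-1}$. For a state $\varphi$ of $\mathcal A$ with $\varphi\circ\sigma(j_1(g))=\varphi$ for all $g\in G$ (a $G$-invariant state) put $F_\varphi=\{h\in F:\varphi\circ\sigma(j_2(h))=\varphi\}$ and $S_\varphi=G\rtimes_\rho F_\varphi\subseteq H$, a closed subgroup, and for $l\in H$ let $\sigma^*(l)(\varphi)=\varphi\circ\sigma(l)^{-1}$; this is again a $G$-invariant state, and $\mathrm{ad}(l):x\mapsto lxl^{-1}$ is an isomorphism of topological groups from $S_\varphi$ onto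 $S_{\sigma^*(l)(\varphi)}$. Let $(\omega_\alpha)_{\alpha\in A}$ be a family of $G$-invariant states of $\mathcal A$. Let $\mu$ be a Haar system associated with it: a family of left Haar measures $\mu_{(\alpha,l)}$ on $S_{\sigma^*(l)(\omega_\alpha)}$, $(\alpha,l)\in A\times H$, such that $\mu_{(\alpha,l)}$ is the image of $\mu_{(\alpha,1)}$ under $\mathrm{ad}(l)$. Let $(\mathfrak H_\alpha,\pi_\alpha,\Omega_\alpha)$ be, for every $\alpha\in A$, a cyclic representation of $\mathcal A$ with $\omega_\alpha(a)=\langle\Omega_\alpha,\pi_\alpha(a)\Omega_\alpha\rangle$ for all $a\in\mathcal A$. For $(\alpha,l)\in A\times H$: * let $B^{\alpha,l}$ be the $C^*$-crossed product $\mathcal A\rtimes_\sigma S_{\sigma^*(l)(\omega_\alpha)}$ formed with $\mu_{(\alpha,l)}$, that is, the completion, in the universal norm given by the nondegenerate covariant representations, of the convolution $*$-algebra $C_c(S_{\sigma^*(l)(\omega_\alpha)},\mathcal A)$; * let $\sigma^{(\omega_\alpha,l)}:B^{\alpha,1}\to B^{\alpha,l}$ be the $*$-isomorphism that extends by continuity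 $f\mapsto\sigma(l)\circ f\circ\mathrm{ad}(l^{-1})$, $f\in C_c(S_{\omega_\alpha},\mathcal A)$; * let $U_\alpha$ be the strongly continuous unitary representation of $S_{\omega_\alpha}$ on $\mathfrak H_\alpha$ determined by $U_\alpha(s)\pi_\alpha(a)\Omega_\alpha=\pi_\alpha(\sigma(s)a)\Omega_\alpha$, and let $U_{\alpha,l}$ be the one of $S_{\sigma^*(l)(\omega_\alpha)}$ determined by $U_{\alpha,l}(s)\pi_\alpha(a)\pi_\alpha(v(l))\Omega_\alpha=\pi_\alpha(\sigma(s)a)\pi_\alpha(v(l))\Omega_\alpha$ (the triple $(\mathfrak H_\alpha,\pi_\alpha,\pi_\alpha(v(l))\Omega_\alpha)$ being a cyclic representation associated with $\sigma^*(l)(\omega_\alpha)$); * let $R_\alpha:B^{\alpha,1}\to\mathcal L(\mathfrak H_\alpha)$ and $R_{v,\alpha,l}:B^{\alpha,l}\to\mathcal L(\mathfrak H_\alpha)$ be the integrated representations, that is, the extensions by continuity of $f\mapsto\int\pi_\alpha(f(s))U_\alpha(s)\,d\mu_{(\alpha,1)}(s)$ and $f\mapsto\int\pi_\alpha(f(s))U_{\alpha,l}(s)\,d\mu_{(\alpha,l)}(s)$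 (integrals in the strong operator topology). Then for all $\alpha\in A$ and $l\in H$ $$R_{v,\alpha,l}\circ\sigma^{(\omega_\alpha,l)}=\mathrm{ad}(\pi_\alpha(v(l)))\circ R_\alpha ,$$ where $\mathrm{ad}(V)(T)=VTV^{-1}$ for a unitary operator $V$ on $\mathfrak H_\alpha$ and $T\in\mathcal L(\mathfrak H_\alpha)$. -/

import Mathlib

open MeasureTheory MeasureTheory.Measure UniformSpace
open scoped CompactlySupported NNReal ComplexOrder

set_option linter.unusedSectionVars false

universe u

noncomputable section

namespace CrossedProducts

/-- A `C*`-dynamical system `(A, X, σ)`: a homomorphism `σ` from the group `X` to the group of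
`*`-automorphisms of the `C*`-algebra `A`, continuous for the topology of pointwise convergence. -/
structure DynSystem (X A : Type*) [Group X] [TopologicalSpace X] [NonUnitalCStarAlgebra A] where
  /-- The action by `*`-automorphisms. -/
  toHom : X →* (A ≃⋆ₐ[ℂ] A)
  continuous_apply : ∀ a : A, Continuous fun x => toHom x a

section Modular

variable {X : Type*} [Group X] [TopologicalSpace X] [IsTopologicalGroup X] [LocallyCompactSpace X]

/-- The modular function `Δ`, normalized by `Δ(s) ∫ f(x s) dμ(x) = ∫ f dμ` for every left Haar
measure `μ`; this is the inverse of Mathlib's `modularCharacter`. -/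
def modularFn (s : X) : ℝ := (((modularCharacter s)⁻¹ : ℝ≥0) : ℝ)

theorem modularFn_mul (s t : X) : modularFn (s * t) = modularFn s * modularFn t := by
  simp [modularFn, mul_comm]

theorem modularFn_one : modularFn (1 : X) = 1 := by simp [modularFn]

theorem modularFn_pos (s : X) : 0 < modularFn s := by
  have : 0 < modularCharacter s := modularCharacterFun_pos s
  have : 0 < (modularCharacter s)⁻¹ := inv_pos.2 this
  exact_mod_cast this

theorem modularFn_inv (s : X) : modularFn s⁻¹ = (modularFn s)⁻¹ := by
  refine eq_inv_of_mul_eq_one_left ?_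
  rw [← modularFn_mul, inv_mul_cancel, modularFn_one]

variable [MeasurableSpace X] [BorelSpace X] (μ : Measure X)
variable {E : Type*} [NormedAddCommGroup E] [NormedSpace ℝ E]

/-- Continuity of compactly supported parametric integrals. -/
theorem continuous_integral [IsFiniteMeasureOnCompacts μ] {Z : Type*} [TopologicalSpace Z] {f : Z → X → E}
    (hf : Continuous f.uncurry) {k : Set X} (hk : IsCompact k)
    (hfs : ∀ p x, x ∉ k → f p x = 0) : Continuous fun p => ∫ x, f p x ∂μ := by
  rw [← continuousOn_univ]
  exact continuousOn_integral_of_compact_support hk hf.continuousOn fun p x _ hx => hfs p x hx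

theorem exists_test [IsHaarMeasure μ] : ∃ f : X → ℝ, Continuous f ∧ HasCompactSupport f ∧ 0 < ∫ x, f x ∂μ := by
  obtain ⟨⟨f, f_cont⟩, f_comp, f_nonneg, f_one⟩ :
    ∃ f : C(X, ℝ), HasCompactSupport f ∧ 0 ≤ f ∧ f 1 ≠ 0 := exists_continuous_nonneg_pos 1
  exact ⟨f, f_cont, f_comp,
    f_cont.integral_pos_of_hasCompactSupport_nonneg_nonzero f_comp f_nonneg f_one⟩

variable [IsHaarMeasure μ] [μ.Regular]

theorem integral_mul_right_modular (f : X → E) (s : X) :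
    ∫ x, f (x * s) ∂μ = modularFn s⁻¹ • ∫ x, f x ∂μ := by
  have h1 : Measure.map (· * s) μ = modularCharacter s • μ := by
    have : (Measure.map (· * s) μ).Regular := Regular.map (Homeomorph.mulRight s)
    have h2 : modularCharacter s = haarScalarFactor (Measure.map (· * s) μ) μ :=
      modularCharacterFun_eq_haarScalarFactor μ s
    rw [h2]
    exact isMulLeftInvariant_eq_smul_of_regular _ μ
  have h3 : ∫ x, f (x * s) ∂μ = ∫ x, f x ∂(Measure.map (· * s) μ) :=
    (integral_map_equiv (MeasurableEquiv.mulRight s) f).symm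
  rw [h3, h1, integral_smul_nnreal_measure]
  simp [modularFn, NNReal.smul_def]

theorem modularFn_mul_integral (f : X → ℝ) (s : X) :
    modularFn s * ∫ x, f (x * s) ∂μ = ∫ x, f x ∂μ := by
  rw [integral_mul_right_modular μ f s, modularFn_inv, smul_eq_mul, ← mul_assoc,
    mul_inv_cancel₀ (modularFn_pos s).ne', one_mul]

theorem continuous_modularFn : Continuous (modularFn : X → ℝ) := by
  borelize X
  let μ : Measure X := haar
  obtain ⟨f, hf, hfc, hpos⟩ := exists_test μ
  have h : (modularFn : X → ℝ) = fun s => ((∫ x, f x ∂μ)⁻¹ * ∫ x, f (x⁻¹ * s) ∂(μ.inv))⁻¹ := by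
    funext s
    have h1 : ∫ x, f (x⁻¹ * s) ∂(μ.inv) = ∫ x, f (x * s) ∂μ := by
      have := integral_map_equiv (μ := μ) (MeasurableEquiv.inv X) (fun x => f (x⁻¹ * s))
      simpa [Measure.inv] using this
    rw [h1, integral_mul_right_modular μ f s, modularFn_inv, smul_eq_mul]
    have := (modularFn_pos s).ne'
    field_simp
  have hne : ∀ s : X, ((∫ x, f x ∂μ)⁻¹ * ∫ x, f (x⁻¹ * s) ∂(μ.inv)) ≠ 0 := by
    intro s h0
    have := congrFun h s
    simp only [h0, inv_zero] at this
    exact (modularFn_pos s).ne' this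
  rw [h]
  exact (continuous_const.mul (continuous_integral_apply_inv_mul hf hfc)).inv₀ hne

/-- Inversion formula for a left Haar measure. -/
theorem integral_inv_modular [CompleteSpace E] {g : X → E} (hg : Continuous g) (hgc : HasCompactSupport g) :
    ∫ s, modularFn s⁻¹ • g s⁻¹ ∂μ = ∫ s, g s ∂μ := by
  obtain ⟨f, hf, hfc, hpos⟩ := exists_test μ
  have hK : IsCompact (tsupport f) := hfc
  have hL : IsCompact (tsupport g) := hgc
  have e1 : ∫ s, ∫ t, f s • g (s⁻¹ * t) ∂μ ∂μ = (∫ x, f x ∂μ) • ∫ x, g x ∂μ := by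
    have : ∀ s, ∫ t, f s • g (s⁻¹ * t) ∂μ = f s • ∫ x, g x ∂μ := fun s => by
      rw [integral_smul, integral_mul_left_eq_self g s⁻¹]
    simp_rw [this]
    rw [integral_smul_const]
  have e2 : ∫ s, ∫ t, f s • g (s⁻¹ * t) ∂μ ∂μ = ∫ t, ∫ s, f s • g (s⁻¹ * t) ∂μ ∂μ := by
    apply integral_integral_swap_of_hasCompactSupport
    · exact (hf.comp continuous_fst).smul (hg.comp (continuous_fst.inv.mul continuous_snd))
    · apply HasCompactSupport.intro (hK.prod (hK.mul hL))
      rintro ⟨s, t⟩ hst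
      by_contra h0
      apply hst
      have hs : f s ≠ 0 := fun h => h0 (by simp [h])
      have ht : g (s⁻¹ * t) ≠ 0 := fun h => h0 (by simp [h])
      exact ⟨subset_tsupport _ hs, Set.mem_mul.2
        ⟨s, subset_tsupport _ hs, s⁻¹ * t, subset_tsupport _ ht, by simp⟩⟩
  have e3 : ∀ t, ∫ s, f s • g (s⁻¹ * t) ∂μ = ∫ s, f (t * s) • g s⁻¹ ∂μ := fun t => by
    rw [← integral_mul_left_eq_self _ t]
    simp
  have e4 : ∫ t, ∫ s, f (t * s) • g s⁻¹ ∂μ ∂μ = ∫ s, ∫ t, f (t * s) • g s⁻¹ ∂μ ∂μ := by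
    apply integral_integral_swap_of_hasCompactSupport
    · exact (hf.comp (continuous_fst.mul continuous_snd)).smul (hg.comp continuous_snd.inv)
    · apply HasCompactSupport.intro ((hK.mul hL).prod hL.inv)
      rintro ⟨t, s⟩ hst
      by_contra h0
      apply hst
      have hs : f (t * s) ≠ 0 := fun h => h0 (by simp [h])
      have ht : g s⁻¹ ≠ 0 := fun h => h0 (by simp [h])
      exact ⟨Set.mem_mul.2 ⟨t * s, subset_tsupport _ hs, s⁻¹, subset_tsupport _ ht, by simp⟩,
        Set.mem_inv.2 (subset_tsupport _ ht)⟩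
  have e5 : ∀ s, ∫ t, f (t * s) • g s⁻¹ ∂μ = (∫ x, f x ∂μ) • modularFn s⁻¹ • g s⁻¹ := fun s => by
    rw [integral_smul_const, integral_mul_right_modular μ f s, smul_smul, smul_eq_mul, mul_comm]
  simp_rw [e3] at e2
  rw [e1, e4] at e2
  simp_rw [e5] at e2
  rw [integral_smul] at e2
  exact (smul_right_injective E hpos.ne' e2).symm

end Modular

section Algebra

variable {X A : Type*} [Group X] [TopologicalSpace X] [NonUnitalCStarAlgebra A]

instance : CoeFun (DynSystem X A) (fun _ => X → A ≃⋆ₐ[ℂ] A) := ⟨fun σ => σ.toHom⟩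

namespace DynSystem

variable (σ : DynSystem X A)

theorem map_mul_apply (s t : X) (a : A) : σ (s * t) a = σ s (σ t a) := by
  rw [map_mul]; rfl

theorem map_one_apply (a : A) : σ 1 a = a := by
  rw [map_one]; rfl

theorem inv_apply_self (s : X) (a : A) : σ s⁻¹ (σ s a) = a := by
  rw [← map_mul_apply, inv_mul_cancel, map_one_apply]

theorem self_inv_apply (s : X) (a : A) : σ s (σ s⁻¹ a) = a := by
  rw [← map_mul_apply, mul_inv_cancel, map_one_apply]

end DynSystem

/-- A `*`-automorphism as a linear isometric equivalence. -/
def autIso (θ : A ≃⋆ₐ[ℂ] A) : A ≃ₗᵢ[ℂ] A where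
  toFun := θ
  invFun := θ.symm
  map_add' := map_add θ
  map_smul' := map_smul θ
  left_inv := θ.symm_apply_apply
  right_inv := θ.apply_symm_apply
  norm_map' := fun a => NonUnitalStarAlgHom.norm_map θ θ.injective a

theorem aut_integral {X : Type*} [MeasurableSpace X] (θ : A ≃⋆ₐ[ℂ] A) (μ : Measure X) (f : X → A) :
    θ (∫ x, f x ∂μ) = ∫ x, θ (f x) ∂μ :=
  ((autIso θ).toContinuousLinearEquiv.integral_comp_comm f).symm

theorem aut_smul_real (θ : A ≃⋆ₐ[ℂ] A) (c : ℝ) (a : A) : θ (c • a) = c • θ a := by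
  rw [← Complex.coe_smul c a, map_smul, Complex.coe_smul]

theorem star_integral' {X : Type*} [MeasurableSpace X] (μ : Measure X) (f : X → A) :
    star (∫ x, f x ∂μ) = ∫ x, star (f x) ∂μ :=
  ((starL' ℝ : A ≃L[ℝ] A).integral_comp_comm f).symm

theorem aut_continuous (θ : A ≃⋆ₐ[ℂ] A) : Continuous θ := (autIso θ).continuous

theorem DynSystem.continuous₂ (σ : DynSystem X A) : Continuous fun p : X × A => σ p.1 p.2 := by
  have h : Continuous fun p : A × X => σ p.2 p.1 := by
    refine continuous_prod_of_continuous_lipschitzWith _ 1 (fun a => σ.continuous_apply a) ?_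
    exact fun x => (autIso (σ x)).lipschitz
  exact h.comp continuous_swap

theorem DynSystem.continuous_comp (σ : DynSystem X A) {Z : Type*} [TopologicalSpace Z]
    {a : Z → X} {b : Z → A} (ha : Continuous a) (hb : Continuous b) :
    Continuous fun z => σ (a z) (b z) :=
  σ.continuous₂.comp (ha.prodMk hb)

theorem mul_integral {X : Type*} [MeasurableSpace X] (μ : Measure X) (a : A) {f : X → A}
    (hf : Integrable f μ) : a * ∫ x, f x ∂μ = ∫ x, a * f x ∂μ :=
  ((ContinuousLinearMap.mul ℂ A a).integral_comp_comm hf).symm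

theorem integral_mul {X : Type*} [MeasurableSpace X] (μ : Measure X) (a : A) {f : X → A}
    (hf : Integrable f μ) : (∫ x, f x ∂μ) * a = ∫ x, f x * a ∂μ :=
  (((ContinuousLinearMap.mul ℂ A).flip a).integral_comp_comm hf).symm

/-- The linear space `C_c(X, A)`, to be equipped with the convolution product and the involution
determined by the action `σ` and the Haar measure `μ`. -/
def CcAlg [MeasurableSpace X] (_σ : DynSystem X A) (_μ : Measure X) : Type _ := C_c(X, A)

end Algebra

namespace CcAlg

variable {X A : Type*} [Group X] [TopologicalSpace X] [NonUnitalCStarAlgebra A]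
variable [MeasurableSpace X] {σ : DynSystem X A} {μ : Measure X}

instance : AddCommGroup (CcAlg σ μ) := inferInstanceAs (AddCommGroup C_c(X, A))
instance : Module ℂ (CcAlg σ μ) := inferInstanceAs (Module ℂ C_c(X, A))
instance : FunLike (CcAlg σ μ) X A := inferInstanceAs (FunLike C_c(X, A) X A)

theorem continuous (f : CcAlg σ μ) : Continuous f := f.1.continuous

theorem hasCompactSupport (f : CcAlg σ μ) : HasCompactSupport f := f.2

theorem isCompact_tsupport (f : CcAlg σ μ) : IsCompact (tsupport f) := f.2

/-- An element of `C_c(X, A)` from a continuous function vanishing off a compact set. -/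
def mk (σ : DynSystem X A) (μ : Measure X) (f : X → A) (hf : Continuous f)
    (hc : HasCompactSupport f) : CcAlg σ μ := (⟨⟨f, hf⟩, hc⟩ : C_c(X, A))

@[simp] theorem mk_apply (f : X → A) (hf : Continuous f) (hc : HasCompactSupport f) (x : X) :
    mk σ μ f hf hc x = f x := rfl

@[ext] theorem ext {f g : CcAlg σ μ} (h : ∀ x, f x = g x) : f = g := DFunLike.ext _ _ h

@[simp] theorem add_apply (f g : CcAlg σ μ) (x : X) : (f + g) x = f x + g x := rfl
@[simp] theorem smul_apply (c : ℂ) (f : CcAlg σ μ) (x : X) : (c • f) x = c • f x := rfl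
@[simp] theorem zero_apply (x : X) : (0 : CcAlg σ μ) x = 0 := rfl

theorem ne_zero_mem {f : CcAlg σ μ} {x : X} (h : f x ≠ 0) : x ∈ tsupport f := subset_tsupport _ h

variable [IsTopologicalGroup X] [LocallyCompactSpace X] [BorelSpace X]

theorem integrable [IsFiniteMeasureOnCompacts μ] (f : CcAlg σ μ) : Integrable f μ :=
  f.continuous.integrable_of_hasCompactSupport f.hasCompactSupport

theorem continuous_integrand (f g : CcAlg σ μ) :
    Continuous fun p : X × X => f p.2 * σ p.2 (g (p.2⁻¹ * p.1)) :=
  (f.continuous.comp continuous_snd).mul (σ.continuous_comp continuous_snd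
    (g.continuous.comp (continuous_snd.inv.mul continuous_fst)))

theorem integrable_integrand [IsFiniteMeasureOnCompacts μ] (f g : CcAlg σ μ) (s : X) :
    Integrable (fun r => f r * σ r (g (r⁻¹ * s))) μ := by
  refine Continuous.integrable_of_hasCompactSupport ?_ ?_
  · exact f.continuous_integrand g |>.comp (continuous_const.prodMk continuous_id)
  · refine HasCompactSupport.intro f.isCompact_tsupport fun r hr => ?_
    rw [image_eq_zero_of_notMem_tsupport hr, zero_mul]

variable [IsHaarMeasure μ]

/-- The convolution product `(f * g)(s) = ∫ f(r) σ_r(g(r⁻¹ s)) dμ(r)`. -/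
instance : Mul (CcAlg σ μ) where
  mul f g := mk σ μ (fun s => ∫ r, f r * σ r (g (r⁻¹ * s)) ∂μ)
    (by
      refine continuous_integral μ (f.continuous_integrand g) f.isCompact_tsupport ?_
      intro s r hr
      rw [image_eq_zero_of_notMem_tsupport hr, zero_mul])
    (by
      refine HasCompactSupport.intro (f.isCompact_tsupport.mul g.isCompact_tsupport) fun s hs => ?_
      refine integral_eq_zero_of_ae (Filter.Eventually.of_forall fun r => ?_)
      by_contra h0
      refine hs (Set.mem_mul.2 ⟨r, ne_zero_mem (f := f) fun h => h0 ?_, r⁻¹ * s,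
        ne_zero_mem (f := g) fun h => h0 ?_, by simp⟩)
      · simp [h]
      · simp [h])

theorem mul_apply (f g : CcAlg σ μ) (s : X) :
    (f * g) s = ∫ r, f r * σ r (g (r⁻¹ * s)) ∂μ := rfl

/-- The involution `f^*(s) = Δ(s⁻¹) σ_s(f(s⁻¹)^*)`. -/
instance : Star (CcAlg σ μ) where
  star f := mk σ μ (fun s => modularFn s⁻¹ • σ s (star (f s⁻¹)))
    ((continuous_modularFn.comp continuous_inv).smul
      (σ.continuous_comp continuous_id (f.continuous.comp continuous_inv).star))
    (by
      refine HasCompactSupport.intro f.isCompact_tsupport.inv fun s hs => ?_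
      have : f s⁻¹ = 0 := image_eq_zero_of_notMem_tsupport hs
      simp [this])

theorem star_apply (f : CcAlg σ μ) (s : X) :
    star f s = modularFn s⁻¹ • σ s (star (f s⁻¹)) := rfl

theorem mul_assoc' (f g h : CcAlg σ μ) : f * g * h = f * (g * h) := by
  ext s
  simp only [mul_apply]
  have e1 : ∀ t, (∫ r, f r * σ r (g (r⁻¹ * t)) ∂μ) * σ t (h (t⁻¹ * s)) =
      ∫ r, f r * σ r (g (r⁻¹ * t)) * σ t (h (t⁻¹ * s)) ∂μ := fun t =>
    integral_mul μ _ (f.integrable_integrand g t)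
  simp_rw [e1]
  rw [integral_integral_swap_of_hasCompactSupport]
  · congr 1
    funext r
    rw [← integral_mul_left_eq_self _ r, aut_integral, mul_integral]
    · congr 1
      funext t
      simp [mul_assoc]
    · exact (autIso (σ r)).toContinuousLinearEquiv.toContinuousLinearMap.integrable_comp
        (g.integrable_integrand h (r⁻¹ * s))
  · exact (f.continuous_integrand g).mul (σ.continuous_comp continuous_fst
      (h.continuous.comp (continuous_fst.inv.mul continuous_const)))
  · refine HasCompactSupport.intro ((f.isCompact_tsupport.mul g.isCompact_tsupport).prod
      f.isCompact_tsupport) ?_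
    rintro ⟨t, r⟩ htr
    by_contra h0
    have hf : f r ≠ 0 := fun h => h0 (by simp [h])
    have hg : g (r⁻¹ * t) ≠ 0 := fun h => h0 (by simp [h])
    exact htr ⟨Set.mem_mul.2 ⟨r, ne_zero_mem hf, _, ne_zero_mem hg, by simp⟩, ne_zero_mem hf⟩

instance : NonUnitalRing (CcAlg σ μ) :=
  { (inferInstance : AddCommGroup (CcAlg σ μ)), (inferInstance : Mul (CcAlg σ μ)) with
    left_distrib := fun f g h => by
      ext s
      simp only [mul_apply, add_apply, map_add, mul_add]
      exact integral_add (f.integrable_integrand g s) (f.integrable_integrand h s)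
    right_distrib := fun f g h => by
      ext s
      simp only [mul_apply, add_apply, add_mul]
      exact integral_add (f.integrable_integrand h s) (g.integrable_integrand h s)
    zero_mul := fun f => by ext s; simp [mul_apply]
    mul_zero := fun f => by ext s; simp [mul_apply]
    mul_assoc := mul_assoc' }

instance : IsScalarTower ℂ (CcAlg σ μ) (CcAlg σ μ) where
  smul_assoc c f g := by
    ext s
    simp only [smul_eq_mul, mul_apply, smul_apply, smul_mul_assoc, integral_smul]

instance : SMulCommClass ℂ (CcAlg σ μ) (CcAlg σ μ) where
  smul_comm c f g := by
    ext s
    simp only [smul_eq_mul, mul_apply, smul_apply, map_smul, mul_smul_comm, integral_smul]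

instance : StarRing (CcAlg σ μ) where
  star_involutive f := by
    ext s
    simp only [star_apply, inv_inv, star_smul, star_trivial, map_star, star_star]
    rw [aut_smul_real, smul_smul,
      ← modularFn_mul, inv_mul_cancel, modularFn_one, one_smul, DynSystem.self_inv_apply]
  star_mul f g := by
    ext s
    simp only [star_apply, mul_apply]
    rw [star_integral', aut_integral, ← integral_mul_left_eq_self _ s⁻¹, ← integral_smul]
    congr 1
    funext r
    have h1 : modularFn (s⁻¹ * r) * modularFn r⁻¹ = modularFn s⁻¹ := by
      rw [← modularFn_mul, mul_inv_cancel_right]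
    simp only [mul_inv_rev, inv_inv, mul_assoc, mul_inv_cancel, mul_one, star_mul, map_mul,
      aut_smul_real, smul_mul_assoc, mul_smul_comm, smul_smul, StarAlgEquiv.mul_apply, map_star,
      DynSystem.self_inv_apply, h1]
  star_add f g := by
    ext s
    simp [star_apply]

instance : StarModule ℂ (CcAlg σ μ) where
  star_smul c f := by
    ext s
    simp only [star_apply, smul_apply, star_smul, map_smul]
    rw [smul_comm]

end CcAlg

section Representations

variable {X A K : Type*} [Group X] [TopologicalSpace X] [NonUnitalCStarAlgebra A]
variable [NormedAddCommGroup K] [InnerProductSpace ℂ K] [CompleteSpace K]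

/-- For a unitary `u`, the `*`-automorphism `ad(u)(a) = u a u⁻¹`. -/
abbrev ad {B : Type*} [CStarAlgebra B] (u : unitary B) : B ≃⋆ₐ[ℂ] B := Unitary.conjStarAlgAut ℂ B u

/-- A nondegenerate covariant representation `(K, π, U)` of a dynamical system: a nondegenerate
`*`-representation `π` of `A` and a strongly continuous unitary representation `U` of `X` on the
Hilbert space `K` such that `π ∘ σ(s) = ad(U(s)) ∘ π`. -/
structure CovRep (σ : DynSystem X A) (K : Type*) [NormedAddCommGroup K] [InnerProductSpace ℂ K]
    [CompleteSpace K] where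
  /-- The representation of the algebra. -/
  π : A →⋆ₙₐ[ℂ] (K →L[ℂ] K)
  /-- The unitary representation of the group. -/
  U : X →* unitary (K →L[ℂ] K)
  continuous_U : ∀ x : K, Continuous fun s => (U s : K →L[ℂ] K) x
  covariant : ∀ s a, π (σ s a) = ad (U s) (π a)
  nondegenerate : Dense (Submodule.span ℂ {y : K | ∃ a x, y = π a x} : Set K)

/-- A `*`-representation as a continuous linear map. -/
def repCLM (π : A →⋆ₙₐ[ℂ] (K →L[ℂ] K)) : A →L[ℂ] (K →L[ℂ] K) :=
  LinearMap.mkContinuous { toFun := π, map_add' := map_add π, map_smul' := map_smul π } 1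
    fun a => by simpa using NonUnitalStarAlgHom.norm_apply_le π a

@[simp] theorem repCLM_apply (π : A →⋆ₙₐ[ℂ] (K →L[ℂ] K)) (a : A) : repCLM π a = π a := rfl

theorem unitary_norm (u : unitary (K →L[ℂ] K)) (x : K) : ‖(u : K →L[ℂ] K) x‖ = ‖x‖ := by
  have h := (ContinuousLinearMap.norm_map_iff_adjoint_comp_self (u : K →L[ℂ] K)).2
    (Unitary.star_mul_self_of_mem u.2)
  exact h x

namespace CovRep

variable {σ : DynSystem X A} (ρ : CovRep σ K)

theorem pi_U (s : X) (a : A) (x : K) :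
    ρ.π (σ s a) ((ρ.U s : K →L[ℂ] K) x) = (ρ.U s : K →L[ℂ] K) (ρ.π a x) := by
  rw [ρ.covariant]
  have h : (ρ.U s * ρ.π a * star (ρ.U s : K →L[ℂ] K)) * (ρ.U s : K →L[ℂ] K) = ρ.U s * ρ.π a := by
    rw [mul_assoc, Unitary.coe_star_mul_self, mul_one]
  exact congrArg (fun T : K →L[ℂ] K => T x) h

theorem U_mul (s t : X) (x : K) :
    (ρ.U (s * t) : K →L[ℂ] K) x = (ρ.U s : K →L[ℂ] K) ((ρ.U t : K →L[ℂ] K) x) := by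
  rw [map_mul]; rfl

theorem continuous_U₂ : Continuous fun p : X × K => (ρ.U p.1 : K →L[ℂ] K) p.2 := by
  have h : Continuous fun p : K × X => (ρ.U p.2 : K →L[ℂ] K) p.1 := by
    refine continuous_prod_of_continuous_lipschitzWith _ 1 ρ.continuous_U ?_
    refine fun s => LipschitzWith.of_dist_le_mul fun x y => ?_
    simp only [dist_eq_norm, ← map_sub, unitary_norm, NNReal.coe_one, one_mul, le_refl]
  exact h.comp continuous_swap

variable [IsTopologicalGroup X] [LocallyCompactSpace X] [MeasurableSpace X] [BorelSpace X]
variable (μ : Measure X)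

theorem continuous_integrand {Z : Type*} [TopologicalSpace Z] {a : Z → A} {s : Z → X} {x : Z → K}
    (ha : Continuous a) (hs : Continuous s) (hx : Continuous x) :
    Continuous fun z => ρ.π (a z) ((ρ.U (s z) : K →L[ℂ] K) (x z)) :=
  ((repCLM ρ.π).continuous.comp ha).clm_apply (ρ.continuous_U₂.comp (hs.prodMk hx))

variable {μ}

theorem integrable_integrand [IsFiniteMeasureOnCompacts μ] (f : CcAlg σ μ) (x : K) :
    Integrable (fun s => ρ.π (f s) ((ρ.U s : K →L[ℂ] K) x)) μ := by
  refine Continuous.integrable_of_hasCompactSupport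
    (ρ.continuous_integrand f.continuous continuous_id continuous_const) ?_
  refine HasCompactSupport.intro f.isCompact_tsupport fun s hs => ?_
  simp [image_eq_zero_of_notMem_tsupport hs]

/-- The operator `∫ π(f(s)) U(s) dμ(s)`, the integral being taken in the strong operator
topology. -/
def integrated [IsFiniteMeasureOnCompacts μ] (f : CcAlg σ μ) : K →L[ℂ] K :=
  LinearMap.mkContinuous
    { toFun := fun x => ∫ s, ρ.π (f s) ((ρ.U s : K →L[ℂ] K) x) ∂μ
      map_add' := fun x y => by
        simp only [map_add]
        exact integral_add (ρ.integrable_integrand f x) (ρ.integrable_integrand f y)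
      map_smul' := fun c x => by
        simp only [map_smul, RingHom.id_apply]
        exact integral_smul c _ }
    (∫ s, ‖f s‖ ∂μ) fun x => by
      rw [← MeasureTheory.integral_mul_const]
      refine norm_integral_le_of_norm_le (f.integrable.norm.mul_const _) ?_
      refine Filter.Eventually.of_forall fun s => ?_
      refine (ContinuousLinearMap.le_opNorm _ _).trans ?_
      rw [unitary_norm]
      gcongr
      exact NonUnitalStarAlgHom.norm_apply_le ρ.π _

theorem integrated_apply [IsFiniteMeasureOnCompacts μ] (f : CcAlg σ μ) (x : K) :
    ρ.integrated f x = ∫ s, ρ.π (f s) ((ρ.U s : K →L[ℂ] K) x) ∂μ := rfl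

theorem norm_integrated_le_L1 [IsFiniteMeasureOnCompacts μ] (f : CcAlg σ μ) :
    ‖ρ.integrated f‖ ≤ ∫ s, ‖f s‖ ∂μ :=
  LinearMap.mkContinuous_norm_le _ (integral_nonneg fun _ => norm_nonneg _) _

theorem integrated_add [IsFiniteMeasureOnCompacts μ] (f g : CcAlg σ μ) :
    ρ.integrated (f + g) = ρ.integrated f + ρ.integrated g := by
  ext x
  simp only [integrated_apply, CcAlg.add_apply, map_add, _root_.add_apply]
  exact integral_add (ρ.integrable_integrand f x) (ρ.integrable_integrand g x)

theorem integrated_smul [IsFiniteMeasureOnCompacts μ] (c : ℂ) (f : CcAlg σ μ) :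
    ρ.integrated (c • f) = c • ρ.integrated f := by
  ext x
  simp only [integrated_apply, CcAlg.smul_apply, map_smul, _root_.smul_apply]
  exact integral_smul c _

variable [IsHaarMeasure μ]

theorem integrated_mul (f g : CcAlg σ μ) :
    ρ.integrated (f * g) = ρ.integrated f * ρ.integrated g := by
  ext x
  change ρ.integrated (f * g) x = ρ.integrated f (ρ.integrated g x)
  rw [integrated_apply, integrated_apply ρ f, integrated_apply ρ g]
  simp only [CcAlg.mul_apply]
  have e1 : ∀ s, ρ.π (∫ r, f r * σ r (g (r⁻¹ * s)) ∂μ) ((ρ.U s : K →L[ℂ] K) x) =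
      ∫ r, ρ.π (f r) (ρ.π (σ r (g (r⁻¹ * s))) ((ρ.U s : K →L[ℂ] K) x)) ∂μ := fun s => by
    have h := ((ContinuousLinearMap.apply ℂ K ((ρ.U s : K →L[ℂ] K) x)).comp
      (repCLM ρ.π)).integral_comp_comm (f.integrable_integrand g s)
    simp only [ContinuousLinearMap.comp_apply, repCLM_apply, ContinuousLinearMap.apply_apply,
      map_mul] at h
    exact h.symm
  simp_rw [e1]
  rw [integral_integral_swap_of_hasCompactSupport]
  · congr 1
    funext r
    rw [← integral_mul_left_eq_self _ r]
    have h := ((ρ.π (f r)).comp (ρ.U r : K →L[ℂ] K)).integral_comp_comm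
      (ρ.integrable_integrand g x)
    simp only [ContinuousLinearMap.comp_apply] at h
    rw [← h]
    congr 1
    funext s
    rw [inv_mul_cancel_left, U_mul, pi_U]
  · exact ((repCLM ρ.π).continuous.comp (f.continuous.comp continuous_snd)).clm_apply
      (ρ.continuous_integrand (σ.continuous_comp continuous_snd
        (g.continuous.comp (continuous_snd.inv.mul continuous_fst))) continuous_fst
        continuous_const)
  · refine HasCompactSupport.intro ((f.isCompact_tsupport.mul g.isCompact_tsupport).prod
      f.isCompact_tsupport) ?_
    rintro ⟨s, r⟩ hsr
    by_contra h0
    have hf : f r ≠ 0 := fun h => h0 (by simp [h])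
    have hg : g (r⁻¹ * s) ≠ 0 := fun h => h0 (by simp [h])
    exact hsr ⟨Set.mem_mul.2 ⟨r, CcAlg.ne_zero_mem hf, _, CcAlg.ne_zero_mem hg, by simp⟩,
      CcAlg.ne_zero_mem hf⟩

theorem integrated_star [μ.Regular] (f : CcAlg σ μ) :
    ρ.integrated (star f) = star (ρ.integrated f) := by
  rw [ContinuousLinearMap.star_eq_adjoint, ContinuousLinearMap.eq_adjoint_iff]
  intro x y
  have hU : ∀ (s : X) (z w : K), inner ℂ ((ρ.U s : K →L[ℂ] K) z) w =
      inner ℂ z ((ρ.U s⁻¹ : K →L[ℂ] K) w) := fun s z w => by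
    rw [map_inv, ← Unitary.star_eq_inv, Unitary.coe_star, ContinuousLinearMap.star_eq_adjoint,
      ContinuousLinearMap.adjoint_inner_right]
  have hp : ∀ (a : A) (z w : K), inner ℂ (ρ.π (star a) z) w = inner ℂ z (ρ.π a w) := fun a z w => by
    rw [map_star, ContinuousLinearMap.star_eq_adjoint, ContinuousLinearMap.adjoint_inner_left]
  rw [integrated_apply, integrated_apply, ← integral_inner (ρ.integrable_integrand f y)]
  have h1 : inner ℂ (∫ s, ρ.π (star f s) ((ρ.U s : K →L[ℂ] K) x) ∂μ) y =
      ∫ s, inner ℂ (ρ.π (star f s) ((ρ.U s : K →L[ℂ] K) x)) y ∂μ := by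
    rw [← inner_conj_symm, ← integral_inner (ρ.integrable_integrand (star f) x), ← integral_conj]
    simp only [inner_conj_symm]
  rw [h1, ← integral_inv_modular μ (g := fun s => inner ℂ x (ρ.π (f s) ((ρ.U s : K →L[ℂ] K) y)))]
  · congr 1
    funext s
    rw [CcAlg.star_apply, ← Complex.coe_smul, map_smul, _root_.smul_apply,
      inner_smul_left, pi_U, hU, hp, Complex.conj_ofReal]
    simp
  · exact continuous_const.inner
      (ρ.continuous_integrand f.continuous continuous_id continuous_const)
  · refine HasCompactSupport.intro f.isCompact_tsupport fun s hs => ?_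
    simp [image_eq_zero_of_notMem_tsupport hs]

end CovRep

end Representations

section CrossedProduct

variable {X A : Type u} [Group X] [TopologicalSpace X] [NonUnitalCStarAlgebra A]
variable [IsTopologicalGroup X] [LocallyCompactSpace X] [MeasurableSpace X] [BorelSpace X]
variable {σ : DynSystem X A} {μ : Measure X}

namespace CcAlg

/-- The values `‖(π ⋊ U)(f)‖`, where `(K, π, U)` runs over the nondegenerate covariant
representations. -/
def normValues [IsFiniteMeasureOnCompacts μ] (f : CcAlg σ μ) : Set ℝ :=
  {r | ∃ (K : Type u) (_ : NormedAddCommGroup K) (_ : InnerProductSpace ℂ K)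
    (_ : CompleteSpace K) (ρ : CovRep σ K), r = ‖ρ.integrated f‖}

/-- The universal norm on `C_c(X, A)`. -/
def universalNorm [IsFiniteMeasureOnCompacts μ] (f : CcAlg σ μ) : ℝ := sSup f.normValues

theorem bddAbove_normValues [IsFiniteMeasureOnCompacts μ] (f : CcAlg σ μ) :
    BddAbove f.normValues := by
  refine ⟨∫ s, ‖f s‖ ∂μ, ?_⟩
  rintro r ⟨K, _, _, _, ρ, rfl⟩
  exact ρ.norm_integrated_le_L1 f

theorem norm_integrated_le [IsFiniteMeasureOnCompacts μ] (f : CcAlg σ μ) {K : Type u}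
    [NormedAddCommGroup K] [InnerProductSpace ℂ K] [CompleteSpace K] (ρ : CovRep σ K) :
    ‖ρ.integrated f‖ ≤ f.universalNorm :=
  le_csSup f.bddAbove_normValues ⟨K, _, _, _, ρ, rfl⟩

theorem universalNorm_nonneg [IsFiniteMeasureOnCompacts μ] (f : CcAlg σ μ) :
    0 ≤ f.universalNorm := by
  refine Real.sSup_nonneg ?_
  rintro r ⟨K, _, _, _, ρ, rfl⟩
  exact norm_nonneg _

theorem universalNorm_le [IsFiniteMeasureOnCompacts μ] (f : CcAlg σ μ) {C : ℝ} (hC : 0 ≤ C)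
    (h : ∀ (K : Type u) [NormedAddCommGroup K] [InnerProductSpace ℂ K] [CompleteSpace K]
      (ρ : CovRep σ K), ‖ρ.integrated f‖ ≤ C) : f.universalNorm ≤ C := by
  refine Real.sSup_le ?_ hC
  rintro r ⟨K, _, _, _, ρ, rfl⟩
  exact h K ρ

theorem universalNorm_add_le [IsFiniteMeasureOnCompacts μ] (f g : CcAlg σ μ) :
    (f + g).universalNorm ≤ f.universalNorm + g.universalNorm := by
  refine universalNorm_le _ (add_nonneg f.universalNorm_nonneg g.universalNorm_nonneg) ?_
  intro K _ _ _ ρ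
  rw [ρ.integrated_add]
  exact (norm_add_le _ _).trans (add_le_add (f.norm_integrated_le ρ) (g.norm_integrated_le ρ))

theorem universalNorm_smul_le [IsFiniteMeasureOnCompacts μ] (c : ℂ) (f : CcAlg σ μ) :
    (c • f).universalNorm ≤ ‖c‖ * f.universalNorm := by
  refine universalNorm_le _ (mul_nonneg (norm_nonneg c) f.universalNorm_nonneg) ?_
  intro K _ _ _ ρ
  rw [ρ.integrated_smul, norm_smul]
  exact mul_le_mul_of_nonneg_left (f.norm_integrated_le ρ) (norm_nonneg c)

instance [IsFiniteMeasureOnCompacts μ] : SeminormedAddCommGroup (CcAlg σ μ) :=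
  AddGroupSeminorm.toSeminormedAddCommGroup
    { toFun := universalNorm
      map_zero' := le_antisymm
        (by simpa using universalNorm_smul_le 0 (0 : CcAlg σ μ)) (universalNorm_nonneg _)
      add_le' := universalNorm_add_le
      neg' := fun f => by
        have h : ∀ g : CcAlg σ μ, (-g).universalNorm ≤ g.universalNorm := fun g => by
          simpa using universalNorm_smul_le (-1) g
        exact le_antisymm (h f) (by simpa using h (-f)) }

theorem norm_def [IsFiniteMeasureOnCompacts μ] (f : CcAlg σ μ) : ‖f‖ = f.universalNorm := rfl

instance [IsFiniteMeasureOnCompacts μ] : NormedSpace ℂ (CcAlg σ μ) where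
  norm_smul_le := universalNorm_smul_le

variable [IsHaarMeasure μ]

theorem universalNorm_mul_le (f g : CcAlg σ μ) :
    (f * g).universalNorm ≤ f.universalNorm * g.universalNorm := by
  refine universalNorm_le _ (mul_nonneg f.universalNorm_nonneg g.universalNorm_nonneg) ?_
  intro K _ _ _ ρ
  rw [ρ.integrated_mul]
  exact (norm_mul_le _ _).trans (mul_le_mul (f.norm_integrated_le ρ) (g.norm_integrated_le ρ)
    (norm_nonneg _) f.universalNorm_nonneg)

instance : NonUnitalSeminormedRing (CcAlg σ μ) :=
  { (inferInstance : SeminormedAddCommGroup (CcAlg σ μ)),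
    (inferInstance : NonUnitalRing (CcAlg σ μ)) with
    norm_mul_le := universalNorm_mul_le }

variable [μ.Regular]

theorem norm_star_le (f : CcAlg σ μ) : ‖star f‖ ≤ ‖f‖ := by
  refine universalNorm_le _ f.universalNorm_nonneg ?_
  intro K _ _ _ ρ
  rw [ρ.integrated_star, norm_star]
  exact f.norm_integrated_le ρ

instance : NormedStarGroup (CcAlg σ μ) where
  norm_star_le := norm_star_le

theorem norm_mul_self_le (f : CcAlg σ μ) : ‖f‖ * ‖f‖ ≤ ‖star f * f‖ := by
  have h : ‖f‖ ≤ √‖star f * f‖ := by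
    refine universalNorm_le _ (Real.sqrt_nonneg _) ?_
    intro K _ _ _ ρ
    refine Real.le_sqrt_of_sq_le ?_
    rw [sq, ← CStarRing.norm_star_mul_self, ← ρ.integrated_star, ← ρ.integrated_mul]
    exact (star f * f).norm_integrated_le ρ
  calc ‖f‖ * ‖f‖ ≤ √‖star f * f‖ * √‖star f * f‖ := by gcongr
    _ = _ := Real.mul_self_sqrt (norm_nonneg _)

end CcAlg

variable [IsHaarMeasure μ] [μ.Regular]

/-- The crossed product: the `C*`-algebra obtained by completing the convolution `*`-algebra
`C_c(X, A)` in its universal norm. -/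
def CrossedProduct (σ : DynSystem X A) (μ : Measure X) [IsHaarMeasure μ] : Type u :=
  Completion (CcAlg σ μ)

namespace CrossedProduct

instance : NormedAddCommGroup (CrossedProduct σ μ) :=
  inferInstanceAs (NormedAddCommGroup (Completion (CcAlg σ μ)))
instance : NormedSpace ℂ (CrossedProduct σ μ) :=
  inferInstanceAs (NormedSpace ℂ (Completion (CcAlg σ μ)))
instance : CompleteSpace (CrossedProduct σ μ) :=
  inferInstanceAs (CompleteSpace (Completion (CcAlg σ μ)))

/-- The canonical map of `C_c(X, A)` into the crossed product. -/
def of (f : CcAlg σ μ) : CrossedProduct σ μ := (f : Completion (CcAlg σ μ))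

theorem of_add (f g : CcAlg σ μ) : of (f + g) = of f + of g := Completion.coe_add f g
theorem of_zero : of (0 : CcAlg σ μ) = 0 := Completion.coe_zero
theorem of_smul (c : ℂ) (f : CcAlg σ μ) : of (c • f) = c • of f := Completion.coe_smul c f
theorem norm_of (f : CcAlg σ μ) : ‖of f‖ = ‖f‖ := Completion.norm_coe f
theorem continuous_of : Continuous (of : CcAlg σ μ → CrossedProduct σ μ) :=
  Completion.continuous_coe _
theorem isDenseInducing_of : IsDenseInducing (of : CcAlg σ μ → CrossedProduct σ μ) :=
  Completion.isDenseInducing_coe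
theorem denseRange_of : DenseRange (of : CcAlg σ μ → CrossedProduct σ μ) :=
  isDenseInducing_of.dense

theorem induction {p : CrossedProduct σ μ → Prop} (hp : IsClosed {x | p x})
    (h : ∀ f : CcAlg σ μ, p (of f)) (x : CrossedProduct σ μ) : p x :=
  denseRange_of.induction_on x hp h

instance : Mul (CrossedProduct σ μ) where
  mul x y := (isDenseInducing_of.prodMap isDenseInducing_of).extend
    (fun p : CcAlg σ μ × CcAlg σ μ => (of (p.1 * p.2) : CrossedProduct σ μ)) (x, y)

instance : Star (CrossedProduct σ μ) where
  star := Completion.map (star : CcAlg σ μ → CcAlg σ μ)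

theorem of_mul (f g : CcAlg σ μ) : of (f * g) = of f * of g :=
  ((isDenseInducing_of.prodMap isDenseInducing_of).extend_eq
    (continuous_of.comp continuous_mul) (f, g)).symm

theorem uniformContinuous_star : UniformContinuous (star : CcAlg σ μ → CcAlg σ μ) :=
  (AddMonoidHomClass.isometry_of_norm (starAddEquiv : CcAlg σ μ ≃+ CcAlg σ μ)
    norm_star).uniformContinuous

theorem of_star (f : CcAlg σ μ) : of (star f) = star (of f) :=
  (Completion.map_coe uniformContinuous_star f).symm

instance : ContinuousStar (CrossedProduct σ μ) := ⟨Completion.continuous_map⟩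

instance : ContinuousMul (CrossedProduct σ μ) where
  continuous_mul := by
    let ofHom : CcAlg σ μ →+ CrossedProduct σ μ :=
      { toFun := of, map_zero' := of_zero, map_add' := of_add }
    let m := (AddMonoidHom.mul : CcAlg σ μ →+ CcAlg σ μ →+ CcAlg σ μ).compr₂ ofHom
    have hm : Continuous fun p : CcAlg σ μ × CcAlg σ μ => m p.1 p.2 :=
      continuous_of.comp continuous_mul
    have di : IsDenseInducing ofHom := isDenseInducing_of
    exact di.extend_Z_bilin di hm

theorem induction₂ {p : CrossedProduct σ μ → CrossedProduct σ μ → Prop}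
    (hp : IsClosed {q : CrossedProduct σ μ × CrossedProduct σ μ | p q.1 q.2})
    (h : ∀ f g : CcAlg σ μ, p (of f) (of g)) (x y : CrossedProduct σ μ) : p x y :=
  denseRange_of.induction_on₂ hp h x y

theorem add_mul_aux (x y z : CrossedProduct σ μ) : (x + y) * z = x * z + y * z := by
  refine denseRange_of.induction_on₃ (p := fun x y z => (x + y) * z = x * z + y * z)
    (isClosed_eq (by fun_prop) (by fun_prop)) (fun f g h => ?_) x y z
  rw [← of_add, ← of_mul, ← of_mul, ← of_mul, ← of_add, add_mul]

theorem mul_add_aux (x y z : CrossedProduct σ μ) : x * (y + z) = x * y + x * z := by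
  refine denseRange_of.induction_on₃ (p := fun x y z => x * (y + z) = x * y + x * z)
    (isClosed_eq (by fun_prop) (by fun_prop)) (fun f g h => ?_) x y z
  rw [← of_add, ← of_mul, ← of_mul, ← of_mul, ← of_add, mul_add]

theorem mul_assoc_aux (x y z : CrossedProduct σ μ) : x * y * z = x * (y * z) := by
  refine denseRange_of.induction_on₃ (p := fun x y z => x * y * z = x * (y * z))
    (isClosed_eq (by fun_prop) (by fun_prop)) (fun f g h => ?_) x y z
  simp only [← of_mul, mul_assoc]

theorem norm_mul_aux (x y : CrossedProduct σ μ) : ‖x * y‖ ≤ ‖x‖ * ‖y‖ := by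
  refine induction₂ (p := fun x y => ‖x * y‖ ≤ ‖x‖ * ‖y‖)
    (isClosed_le (by fun_prop) (by fun_prop)) (fun f g => ?_) x y
  rw [← of_mul, norm_of, norm_of, norm_of]
  exact norm_mul_le f g

instance : NonUnitalNormedRing (CrossedProduct σ μ) :=
  { (inferInstance : NormedAddCommGroup (CrossedProduct σ μ)),
    (inferInstance : Mul (CrossedProduct σ μ)) with
    left_distrib := mul_add_aux
    right_distrib := add_mul_aux
    zero_mul := fun x => by
      have h := add_mul_aux 0 0 x
      rwa [add_zero, left_eq_add] at h
    mul_zero := fun x => by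
      have h := mul_add_aux x 0 0
      rwa [add_zero, left_eq_add] at h
    mul_assoc := mul_assoc_aux
    norm_mul_le := norm_mul_aux }

instance : StarRing (CrossedProduct σ μ) where
  star_involutive x := by
    refine induction (p := fun x => star (star x) = x) (isClosed_eq (by fun_prop) (by fun_prop))
      (fun f => ?_) x
    rw [← of_star, ← of_star, star_star]
  star_mul x y := by
    refine induction₂ (p := fun x y => star (x * y) = star y * star x)
      (isClosed_eq (by fun_prop) (by fun_prop)) (fun f g => ?_) x y
    rw [← of_mul, ← of_star, star_mul, of_mul, of_star, of_star]
  star_add x y := by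
    refine induction₂ (p := fun x y => star (x + y) = star x + star y)
      (isClosed_eq (by fun_prop) (by fun_prop)) (fun f g => ?_) x y
    rw [← of_add, ← of_star, star_add, of_add, of_star, of_star]

instance : CStarRing (CrossedProduct σ μ) where
  norm_mul_self_le x := by
    refine induction (p := fun x => ‖x‖ * ‖x‖ ≤ ‖star x * x‖)
      (isClosed_le (by fun_prop) (by fun_prop)) (fun f => ?_) x
    rw [← of_star, ← of_mul, norm_of, norm_of]
    exact f.norm_mul_self_le

instance : IsScalarTower ℂ (CrossedProduct σ μ) (CrossedProduct σ μ) where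
  smul_assoc c x y := by
    change (c • x) * y = c • (x * y)
    refine induction₂ (p := fun x y => (c • x) * y = c • (x * y))
      (isClosed_eq (((continuous_const_smul c).comp continuous_fst).mul continuous_snd)
        ((continuous_fst.mul continuous_snd).const_smul c)) (fun f g => ?_) x y
    rw [← of_smul, ← of_mul, ← of_mul, ← of_smul, smul_mul_assoc]

instance : SMulCommClass ℂ (CrossedProduct σ μ) (CrossedProduct σ μ) where
  smul_comm c x y := by
    change c • (x * y) = x * (c • y)
    refine induction₂ (p := fun x y => c • (x * y) = x * (c • y))
      (isClosed_eq ((continuous_fst.mul continuous_snd).const_smul c)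
        (continuous_fst.mul ((continuous_const_smul c).comp continuous_snd))) (fun f g => ?_) x y
    rw [← of_smul, ← of_mul, ← of_mul, ← of_smul, mul_smul_comm]

instance : StarModule ℂ (CrossedProduct σ μ) where
  star_smul c x := by
    refine induction (p := fun x => star (c • x) = star c • star x)
      (isClosed_eq (continuous_star.comp (continuous_const_smul c))
        ((continuous_const_smul (star c)).comp continuous_star)) (fun f => ?_) x
    rw [← of_smul, ← of_star, ← of_star, star_smul, of_smul]

instance : NonUnitalCStarAlgebra (CrossedProduct σ μ) where

/-- The canonical map of `C_c(X, A)` into the crossed product, as a linear map. -/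
def ofLin : CcAlg σ μ →ₗ[ℂ] CrossedProduct σ μ where
  toFun := of
  map_add' := of_add
  map_smul' := of_smul

end CrossedProduct

open CrossedProduct

/-- The integrated form `π ⋊ U` of a covariant representation: the extension by continuity to the
crossed product of `f ↦ ∫ π(f(s)) U(s) dμ(s)`. -/
def CovRep.integratedForm {K : Type u} [NormedAddCommGroup K] [InnerProductSpace ℂ K]
    [CompleteSpace K] (ρ : CovRep σ K) (μ : Measure X) [IsHaarMeasure μ] [μ.Regular] :
    CrossedProduct σ μ →⋆ₙₐ[ℂ] (K →L[ℂ] K) :=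
  let L : CcAlg σ μ →ₗ[ℂ] (K →L[ℂ] K) :=
    { toFun := ρ.integrated, map_add' := ρ.integrated_add, map_smul' := ρ.integrated_smul }
  let R : CrossedProduct σ μ →L[ℂ] (K →L[ℂ] K) := L.extendOfNorm ofLin
  have hR : ∀ f : CcAlg σ μ, R (of f) = ρ.integrated f := fun f =>
    LinearMap.extendOfNorm_eq (e := ofLin) denseRange_of
      ⟨1, fun g => by
        rw [one_mul]; exact (g.norm_integrated_le ρ).trans_eq (norm_of g).symm⟩ f
  { toFun := R
    map_smul' := map_smul R
    map_zero' := map_zero R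
    map_add' := map_add R
    map_mul' := fun x y => by
      refine induction₂ (p := fun x y => R (x * y) = R x * R y)
        (isClosed_eq (by fun_prop) (by fun_prop)) (fun f g => ?_) x y
      rw [← of_mul, hR, hR, hR, ρ.integrated_mul]
    map_star' := fun x => by
      refine induction (p := fun x => R (star x) = star (R x))
        (isClosed_eq (by fun_prop) (by fun_prop)) (fun f => ?_) x
      rw [← of_star, hR, hR, ρ.integrated_star] }

theorem CovRep.integratedForm_of {K : Type u} [NormedAddCommGroup K] [InnerProductSpace ℂ K]
    [CompleteSpace K] (ρ : CovRep σ K) (f : CcAlg σ μ) :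
    ρ.integratedForm μ (of f) = ρ.integrated f :=
  LinearMap.extendOfNorm_eq (e := ofLin) denseRange_of
    ⟨1, fun g => by
      rw [one_mul]; exact (g.norm_integrated_le ρ).trans_eq (norm_of g).symm⟩ f

end CrossedProduct

section Transport

variable {X Y A : Type u} [NonUnitalCStarAlgebra A]
variable [Group X] [TopologicalSpace X] [IsTopologicalGroup X] [LocallyCompactSpace X]
variable [MeasurableSpace X] [BorelSpace X]
variable [Group Y] [TopologicalSpace Y] [IsTopologicalGroup Y] [LocallyCompactSpace Y]
variable [MeasurableSpace Y] [BorelSpace Y]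
variable {σ : DynSystem X A} {τ : DynSystem Y A} {μ : Measure X} {ν : Measure Y}
variable (e : X ≃ₜ* Y) (θ : A ≃⋆ₐ[ℂ] A)

theorem integral_transport {E : Type*} [NormedAddCommGroup E] [NormedSpace ℝ E]
    (hν : ν = Measure.map e μ) (f : Y → E) : ∫ y, f y ∂ν = ∫ x, f (e x) ∂μ := by
  subst hν
  exact integral_map_equiv e.toHomeomorph.toMeasurableEquiv f

theorem modularFn_transport [IsHaarMeasure μ] [μ.Regular] [IsHaarMeasure ν] [ν.Regular]
    (hν : ν = Measure.map e μ) (x : X) : modularFn (e x) = modularFn x := by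
  obtain ⟨f, -, -, hpos⟩ := exists_test ν
  have h1 := modularFn_mul_integral ν f (e x)
  have h2 := modularFn_mul_integral μ (fun t => f (e t)) x
  rw [← h1, integral_transport e hν] at hpos
  rw [integral_transport e hν, integral_transport e hν] at h1
  simp only [map_mul] at h2
  rw [← h1] at h2
  exact (mul_right_cancel₀ (right_ne_zero_of_mul hpos.ne') h2).symm

namespace CcAlg

/-- The map `f ↦ θ ∘ f ∘ e⁻¹` from `C_c(X, A)` to `C_c(Y, A)`. -/
def transport (τ : DynSystem Y A) (ν : Measure Y) : CcAlg σ μ →ₗ[ℂ] CcAlg τ ν where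
  toFun f := mk τ ν (fun y => θ (f (e.symm y)))
    ((aut_continuous θ).comp (f.continuous.comp e.symm.continuous))
    ((f.hasCompactSupport.comp_homeomorph e.symm.toHomeomorph).comp_left (map_zero θ))
  map_add' f g := by ext y; simp
  map_smul' c f := by ext y; simp

@[simp] theorem transport_apply (f : CcAlg σ μ) (y : Y) :
    transport e θ τ ν f y = θ (f (e.symm y)) := rfl

variable [IsHaarMeasure μ] [IsHaarMeasure ν]

theorem transport_mul (hθ : ∀ x a, θ (σ x a) = τ (e x) (θ a)) (hν : ν = Measure.map e μ)
    (f g : CcAlg σ μ) :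
    transport e θ τ ν (f * g) = transport e θ τ ν f * transport e θ τ ν g := by
  ext y
  simp only [transport_apply, mul_apply, aut_integral, integral_transport e hν]
  congr 1
  funext r
  simp [hθ]

theorem transport_star [μ.Regular] [ν.Regular] (hθ : ∀ x a, θ (σ x a) = τ (e x) (θ a))
    (hν : ν = Measure.map e μ) (f : CcAlg σ μ) :
    transport e θ τ ν (star f) = star (transport e θ τ ν f) := by
  ext y
  obtain ⟨x, rfl⟩ := e.surjective y
  simp only [transport_apply, star_apply, aut_smul_real, hθ, map_star, map_inv]
  rw [← map_inv e, modularFn_transport e hν]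
  simp

end CcAlg

/-- The covariant representation `(K, π ∘ θ, U ∘ e)`. -/
def CovRep.pullback (hθ : ∀ x a, θ (σ x a) = τ (e x) (θ a)) {K : Type*} [NormedAddCommGroup K]
    [InnerProductSpace ℂ K] [CompleteSpace K] (ρ : CovRep τ K) : CovRep σ K where
  π := ρ.π.comp (θ : A →⋆ₙₐ[ℂ] A)
  U := ρ.U.comp (e : X →* Y)
  continuous_U x := (ρ.continuous_U x).comp e.continuous
  covariant s a := by
    change ρ.π (θ (σ s a)) = ad (ρ.U (e s)) (ρ.π (θ a))
    rw [hθ, ρ.covariant]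
  nondegenerate := by
    refine ρ.nondegenerate.mono (Submodule.span_mono ?_)
    rintro y ⟨a, x, h⟩
    exact ⟨θ.symm a, x, by rw [h]; change _ = ρ.π (θ (θ.symm a)) x; simp⟩

theorem CovRep.integrated_transport [IsFiniteMeasureOnCompacts μ] [IsFiniteMeasureOnCompacts ν]
    (hθ : ∀ x a, θ (σ x a) = τ (e x) (θ a)) (hν : ν = Measure.map e μ) {K : Type*}
    [NormedAddCommGroup K] [InnerProductSpace ℂ K] [CompleteSpace K] (ρ : CovRep τ K)
    (f : CcAlg σ μ) :
    ρ.integrated (CcAlg.transport e θ τ ν f) = (ρ.pullback e θ hθ).integrated f := by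
  ext x
  rw [integrated_apply, integrated_apply, integral_transport e hν]
  simp [pullback]

theorem CcAlg.norm_transport_le [IsFiniteMeasureOnCompacts μ] [IsFiniteMeasureOnCompacts ν]
    (hθ : ∀ x a, θ (σ x a) = τ (e x) (θ a)) (hν : ν = Measure.map e μ) (f : CcAlg σ μ) :
    ‖transport e θ τ ν f‖ ≤ ‖f‖ := by
  refine universalNorm_le _ f.universalNorm_nonneg ?_
  intro K _ _ _ ρ
  rw [CovRep.integrated_transport e θ hθ hν]
  exact f.norm_integrated_le _

variable [IsHaarMeasure μ] [μ.Regular] [IsHaarMeasure ν] [ν.Regular]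

namespace CrossedProduct

/-- The extension by continuity of `f ↦ θ ∘ f ∘ e⁻¹` to the crossed products. -/
def transport (τ : DynSystem Y A) (ν : Measure Y) [IsHaarMeasure ν] [ν.Regular] :
    CrossedProduct σ μ →L[ℂ] CrossedProduct τ ν :=
  (ofLin ∘ₗ CcAlg.transport (σ := σ) (μ := μ) e θ τ ν).extendOfNorm ofLin

theorem transport_of (hθ : ∀ x a, θ (σ x a) = τ (e x) (θ a)) (hν : ν = Measure.map e μ)
    (f : CcAlg σ μ) : transport e θ τ ν (of f) = of (CcAlg.transport e θ τ ν f) :=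
  LinearMap.extendOfNorm_eq (f := ofLin ∘ₗ CcAlg.transport e θ τ ν) (e := ofLin) denseRange_of
    ⟨1, fun g => by
      rw [one_mul]
      exact (norm_of _).trans_le ((g.norm_transport_le e θ hθ hν).trans_eq (norm_of g).symm)⟩ f

theorem transport_symm (hθ : ∀ x a, θ (σ x a) = τ (e x) (θ a)) (hν : ν = Measure.map e μ)
    (x : CrossedProduct σ μ) :
    transport e.symm θ.symm σ μ (transport e θ τ ν x) = x := by
  have hθ' : ∀ y a, θ.symm (τ y a) = σ (e.symm y) (θ.symm a) := fun y a => by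
    rw [StarAlgEquiv.symm_apply_eq, hθ]
    simp
  have hν' : μ = Measure.map e.symm ν := by
    subst hν
    exact (e.toHomeomorph.toMeasurableEquiv.map_symm_map).symm
  refine induction (p := fun x => transport e.symm θ.symm σ μ (transport e θ τ ν x) = x)
    (isClosed_eq (by fun_prop) continuous_id) (fun f => ?_) x
  rw [transport_of e θ hθ hν, transport_of e.symm θ.symm hθ' hν']
  congr 1
  ext s
  simp

/-- An isomorphism `e` of topological groups carrying `μ` to `ν`, and an automorphism `θ` of `A`
that intertwines `σ(x)` and `τ(e(x))`, induce a `*`-isomorphism of crossed products, the extension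
by continuity of `f ↦ θ ∘ f ∘ e⁻¹`. -/
def congr (hθ : ∀ x a, θ (σ x a) = τ (e x) (θ a)) (hν : ν = Measure.map e μ) :
    CrossedProduct σ μ ≃⋆ₐ[ℂ] CrossedProduct τ ν where
  toFun := transport e θ τ ν
  invFun := transport e.symm θ.symm σ μ
  left_inv := transport_symm e θ hθ hν
  right_inv := by
    have hθ' : ∀ y a, θ.symm (τ y a) = σ (e.symm y) (θ.symm a) := fun y a => by
      rw [StarAlgEquiv.symm_apply_eq, hθ]
      simp
    have hν' : μ = Measure.map e.symm ν := by
      subst hν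
      exact (e.toHomeomorph.toMeasurableEquiv.map_symm_map).symm
    exact transport_symm e.symm θ.symm hθ' hν'
  map_add' := map_add _
  map_smul' := map_smul _
  map_mul' x y := by
    refine induction₂ (p := fun x y => transport e θ τ ν (x * y) =
      transport e θ τ ν x * transport e θ τ ν y)
      (isClosed_eq (by fun_prop) (by fun_prop)) (fun f g => ?_) x y
    rw [← of_mul, transport_of e θ hθ hν, transport_of e θ hθ hν, transport_of e θ hθ hν,
      CcAlg.transport_mul e θ hθ hν, of_mul]
  map_star' x := by
    refine induction (p := fun x => transport e θ τ ν (star x) = star (transport e θ τ ν x))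
      (isClosed_eq (by fun_prop) (by fun_prop)) (fun f => ?_) x
    rw [← of_star, transport_of e θ hθ hν, transport_of e θ hθ hν,
      CcAlg.transport_star e θ hθ hν, of_star]

theorem congr_of (hθ : ∀ x a, θ (σ x a) = τ (e x) (θ a)) (hν : ν = Measure.map e μ)
    (f : CcAlg σ μ) : congr e θ hθ hν (of f) = of (CcAlg.transport e θ τ ν f) :=
  transport_of e θ hθ hν f

end CrossedProduct

end Transport

section Cyclic

/-- A state of a `C*`-algebra: a positive linear functional of norm one. -/
def IsState {A : Type*} [NonUnitalCStarAlgebra A] (ω : A →L[ℂ] ℂ) : Prop :=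
  (∀ a : A, 0 ≤ ω (star a * a)) ∧ ‖ω‖ = 1

/-- A cyclic `*`-representation `(K, π, Ω)` of `A` on the Hilbert space `K`. -/
structure CyclicRep (A K : Type*) [NonUnitalCStarAlgebra A] [NormedAddCommGroup K]
    [InnerProductSpace ℂ K] [CompleteSpace K] where
  /-- The representation. -/
  π : A →⋆ₙₐ[ℂ] (K →L[ℂ] K)
  /-- The cyclic vector. -/
  Ω : K
  cyclic : Dense (Set.range fun a => π a Ω)

variable {X A K : Type*} [Group X] [TopologicalSpace X] [NonUnitalCStarAlgebra A]
variable [NormedAddCommGroup K] [InnerProductSpace ℂ K] [CompleteSpace K]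

theorem continuous_of_dense {T : X → K →L[ℂ] K} {D : Set K} (hD : Dense D)
    (hT : ∀ s x, ‖T s x‖ = ‖x‖) (h : ∀ x ∈ D, Continuous fun s => T s x) (x : K) :
    Continuous fun s => T s x := by
  have hl : ∀ s, LipschitzWith 1 (T s) := fun s => LipschitzWith.of_dist_le_mul fun y z => by
    rw [dist_eq_norm, dist_eq_norm, ← map_sub, hT, NNReal.coe_one, one_mul]
  have h : Continuous fun p : K × X => T p.2 p.1 :=
    continuous_prod_of_dense_continuous_lipschitzWith (fun p : K × X => T p.2 p.1) 1 hD h hl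
  exact h.comp (continuous_const.prodMk continuous_id)

namespace CyclicRep

variable (c : CyclicRep A K) {ω : A →L[ℂ] ℂ}

/-- The cyclic representation is associated with the functional `ω = ⟨Ω, π(·) Ω⟩`. -/
def IsAssociated (c : CyclicRep A K) (ω : A →L[ℂ] ℂ) : Prop :=
  ∀ a, ω a = inner ℂ c.Ω (c.π a c.Ω)

/-- The map `a ↦ π(a) Ω`. -/
def vec : A →ₗ[ℂ] K where
  toFun a := c.π a c.Ω
  map_add' a b := by simp
  map_smul' t a := by simp

theorem vec_apply (a : A) : c.vec a = c.π a c.Ω := rfl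

theorem denseRange_vec : DenseRange c.vec := c.cyclic

theorem continuous_vec : Continuous c.vec :=
  ((ContinuousLinearMap.apply ℂ K c.Ω).comp (repCLM c.π)).continuous

theorem inner_vec (hc : c.IsAssociated ω) (a b : A) :
    inner ℂ (c.vec a) (c.vec b) = ω (star a * b) := by
  rw [hc, map_mul, map_star, ContinuousLinearMap.star_eq_adjoint, vec_apply, vec_apply]
  exact (ContinuousLinearMap.adjoint_inner_right _ _ _).symm

variable (σ : DynSystem X A)

theorem norm_vec (hc : c.IsAssociated ω) (hω : ∀ s a, ω (σ s a) = ω a) (s : X) (a : A) :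
    ‖c.vec (σ s a)‖ = ‖c.vec a‖ := by
  have h : (inner ℂ (c.vec (σ s a)) (c.vec (σ s a)) : ℂ) = inner ℂ (c.vec a) (c.vec a) := by
    rw [c.inner_vec hc, c.inner_vec hc, ← map_star, ← map_mul, hω]
  rw [inner_self_eq_norm_sq_to_K, inner_self_eq_norm_sq_to_K] at h
  have h' : ‖c.vec (σ s a)‖ ^ 2 = ‖c.vec a‖ ^ 2 := by exact_mod_cast h
  exact (sq_eq_sq₀ (norm_nonneg _) (norm_nonneg _)).1 h'

/-- The operator determined by `π(a) Ω ↦ π(σ(s) a) Ω`. -/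
def W (s : X) : K →L[ℂ] K :=
  (c.vec ∘ₗ ((autIso (σ s)).toLinearEquiv : A →ₗ[ℂ] A)).extendOfNorm c.vec

theorem W_vec (hc : c.IsAssociated ω) (hω : ∀ s a, ω (σ s a) = ω a) (s : X) (a : A) :
    c.W σ s (c.vec a) = c.vec (σ s a) :=
  LinearMap.extendOfNorm_eq c.denseRange_vec
    ⟨1, fun b => by rw [one_mul]; exact (c.norm_vec σ hc hω s b).le⟩ a

theorem W_mul (hc : c.IsAssociated ω) (hω : ∀ s a, ω (σ s a) = ω a) (s t : X) :
    c.W σ (s * t) = c.W σ s * c.W σ t := by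
  ext x
  refine c.denseRange_vec.induction_on (p := fun x => c.W σ (s * t) x = (c.W σ s * c.W σ t) x) x
    (isClosed_eq (by fun_prop) (by fun_prop)) fun a => ?_
  change _ = c.W σ s (c.W σ t _)
  rw [c.W_vec σ hc hω, c.W_vec σ hc hω, c.W_vec σ hc hω, σ.map_mul_apply]

theorem W_one (hc : c.IsAssociated ω) (hω : ∀ s a, ω (σ s a) = ω a) : c.W σ 1 = 1 := by
  ext x
  refine c.denseRange_vec.induction_on (p := fun x => c.W σ 1 x = x) x
    (isClosed_eq (by fun_prop) (by fun_prop)) fun a => ?_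
  rw [c.W_vec σ hc hω, σ.map_one_apply]

theorem norm_W (hc : c.IsAssociated ω) (hω : ∀ s a, ω (σ s a) = ω a) (s : X) (x : K) :
    ‖c.W σ s x‖ = ‖x‖ := by
  refine c.denseRange_vec.induction_on (p := fun x => ‖c.W σ s x‖ = ‖x‖) x
    (isClosed_eq (by fun_prop) (by fun_prop)) fun a => ?_
  rw [c.W_vec σ hc hω, c.norm_vec σ hc hω]

theorem W_mem_unitary (hc : c.IsAssociated ω) (hω : ∀ s a, ω (σ s a) = ω a) (s : X) :
    c.W σ s ∈ unitary (K →L[ℂ] K) := by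
  have h1 : star (c.W σ s) * c.W σ s = 1 :=
    (ContinuousLinearMap.norm_map_iff_adjoint_comp_self (c.W σ s)).1 (c.norm_W σ hc hω s)
  have h2 : c.W σ s * c.W σ s⁻¹ = 1 := by
    rw [← c.W_mul σ hc hω, mul_inv_cancel, c.W_one σ hc hω]
  refine Unitary.mem_iff.2 ⟨h1, ?_⟩
  rw [left_inv_eq_right_inv h1 h2, h2]

theorem continuous_W (hc : c.IsAssociated ω) (hω : ∀ s a, ω (σ s a) = ω a) (x : K) :
    Continuous fun s => c.W σ s x := by
  refine continuous_of_dense c.denseRange_vec (c.norm_W σ hc hω) ?_ x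
  rintro _ ⟨a, rfl⟩
  have h := c.continuous_vec.comp (σ.continuous_apply a)
  exact h.congr fun s => (c.W_vec σ hc hω s a).symm

theorem vec_mul (a b : A) : c.vec (a * b) = c.π a (c.vec b) := by
  rw [vec_apply, vec_apply, map_mul]; rfl

theorem W_comm (hc : c.IsAssociated ω) (hω : ∀ s a, ω (σ s a) = ω a) (s : X) (a : A) :
    c.W σ s * c.π a = c.π (σ s a) * c.W σ s := by
  ext x
  change c.W σ s (c.π a x) = c.π (σ s a) (c.W σ s x)
  refine c.denseRange_vec.induction_on
    (p := fun x => c.W σ s (c.π a x) = c.π (σ s a) (c.W σ s x)) x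
    (isClosed_eq ((c.W σ s).continuous.comp (c.π a).continuous)
      ((c.π (σ s a)).continuous.comp (c.W σ s).continuous)) fun b => ?_
  rw [← vec_mul, c.W_vec σ hc hω, c.W_vec σ hc hω, map_mul, vec_mul]

theorem W_covariant (hc : c.IsAssociated ω) (hω : ∀ s a, ω (σ s a) = ω a) (s : X) (a : A) :
    c.π (σ s a) = c.W σ s * c.π a * star (c.W σ s) := by
  rw [c.W_comm σ hc hω, mul_assoc, (Unitary.mem_iff.1 (c.W_mem_unitary σ hc hω s)).2, mul_one]

/-- The covariant representation `(K, π, W)` induced by a cyclic representation `(K, π, Ω)`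
associated with a `σ`-invariant functional: `W` is determined by `W(s) π(a) Ω = π(σ(s) a) Ω`. -/
def covRep (hc : c.IsAssociated ω) (hω : ∀ s a, ω (σ s a) = ω a) : CovRep σ K where
  π := c.π
  U :=
    { toFun := fun s => ⟨c.W σ s, c.W_mem_unitary σ hc hω s⟩
      map_one' := Subtype.ext (c.W_one σ hc hω)
      map_mul' := fun s t => Subtype.ext (c.W_mul σ hc hω s t) }
  continuous_U := c.continuous_W σ hc hω
  covariant := c.W_covariant σ hc hω
  nondegenerate := by
    refine c.cyclic.mono ?_
    rintro _ ⟨a, rfl⟩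
    exact Submodule.subset_span ⟨a, c.Ω, rfl⟩

theorem covRep_U_apply (hc : c.IsAssociated ω) (hω : ∀ s a, ω (σ s a) = ω a) (s : X) (a : A) :
    ((c.covRep σ hc hω).U s : K →L[ℂ] K) (c.π a c.Ω) = c.π (σ s a) c.Ω :=
  c.W_vec σ hc hω s a

end CyclicRep

end Cyclic

section Semidirect

variable {G F : Type*} [Group G] [TopologicalSpace G] [Group F] [TopologicalSpace F]
variable {ρ : F →* MulAut G}

/-- The semidirect product carries the product topology of `G × F`. -/
instance : TopologicalSpace (G ⋊[ρ] F) :=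
  TopologicalSpace.induced SemidirectProduct.equivProd inferInstance

/-- The Borel `σ`-algebra of the semidirect product. -/
instance : MeasurableSpace (G ⋊[ρ] F) := borel _

instance : BorelSpace (G ⋊[ρ] F) := ⟨rfl⟩

/-- The map `(g, f) ↦ ρ_f(g)` is continuous. -/
class IsContinuousAction (ρ : F →* MulAut G) : Prop where
  continuous_action : Continuous fun p : G × F => ρ p.2 p.1

/-- The identification of the semidirect product with `G × F` as topological spaces. -/
def homeoProd : G ⋊[ρ] F ≃ₜ G × F :=
  SemidirectProduct.equivProd.toHomeomorphOfIsInducing ⟨rfl⟩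

theorem continuous_left : Continuous fun x : G ⋊[ρ] F => x.left :=
  continuous_fst.comp homeoProd.continuous

theorem continuous_right : Continuous fun x : G ⋊[ρ] F => x.right :=
  continuous_snd.comp homeoProd.continuous

instance [T2Space G] [T2Space F] : T2Space (G ⋊[ρ] F) := homeoProd.symm.t2Space

instance [LocallyCompactSpace G] [LocallyCompactSpace F] : LocallyCompactSpace (G ⋊[ρ] F) :=
  homeoProd.isClosedEmbedding.locallyCompactSpace

theorem continuous_of_comp {Z : Type*} [TopologicalSpace Z] {f : Z → G ⋊[ρ] F}
    (h1 : Continuous fun z => (f z).left) (h2 : Continuous fun z => (f z).right) :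
    Continuous f :=
  homeoProd.isInducing.continuous_iff.2 (h1.prodMk h2)

instance [IsTopologicalGroup G] [IsTopologicalGroup F] [h : IsContinuousAction ρ] :
    IsTopologicalGroup (G ⋊[ρ] F) where
  continuous_mul := by
    refine continuous_of_comp ?_ ?_
    · exact (continuous_left.comp continuous_fst).mul (h.continuous_action.comp
        ((continuous_left.comp continuous_snd).prodMk (continuous_right.comp continuous_fst)))
    · exact (continuous_right.comp continuous_fst).mul (continuous_right.comp continuous_snd)
  continuous_inv := by
    refine continuous_of_comp ?_ ?_
    · exact h.continuous_action.comp (continuous_left.inv.prodMk continuous_right.inv)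
    · exact continuous_right.inv

end Semidirect

section Main

variable {G F A : Type u} [Group G] [TopologicalSpace G] [IsTopologicalGroup G] [T2Space G]
variable [LocallyCompactSpace G]
variable [Group F] [TopologicalSpace F] [IsTopologicalGroup F] [T2Space F] [LocallyCompactSpace F]
variable {ρ : F →* MulAut G} [IsContinuousAction ρ] [NonUnitalCStarAlgebra A]
variable (σ : DynSystem (G ⋊[ρ] F) A)

/-- The set `E_A^G(τ)` of the states of `A` that are invariant under the restriction
`τ = σ ∘ j₁` of the action to `G`. -/
structure InvState where
  /-- The functional. -/
  functional : A →L[ℂ] ℂ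
  isState : IsState functional
  invariant : ∀ (g : G) (a : A), functional (σ (SemidirectProduct.inl g) a) = functional a

variable {σ}

@[ext] theorem InvState.ext {φ ψ : InvState σ} (h : ∀ a, φ.functional a = ψ.functional a) :
    φ = ψ := by
  obtain ⟨φ, _, _⟩ := φ
  obtain ⟨ψ, _, _⟩ := ψ
  obtain rfl : φ = ψ := ContinuousLinearMap.ext h
  rfl

/-- The action `σ^*(l)(φ) = φ ∘ σ(l)⁻¹` of the group on the `G`-invariant states. -/
def InvState.act (l : G ⋊[ρ] F) (φ : InvState σ) : InvState σ where
  functional := φ.functional ∘L ((autIso (σ l⁻¹)).toContinuousLinearEquiv : A →L[ℂ] A)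
  isState := by
    refine ⟨fun a => ?_, ?_⟩
    · change 0 ≤ φ.functional (σ l⁻¹ (star a * a))
      rw [map_mul, map_star]
      exact φ.isState.1 _
    · rw [← φ.isState.2]
      exact ContinuousLinearMap.opNorm_comp_linearIsometryEquiv φ.functional (autIso (σ l⁻¹))
  invariant g a := by
    change φ.functional (σ l⁻¹ (σ (SemidirectProduct.inl g) a)) = φ.functional (σ l⁻¹ a)
    obtain ⟨g', hg'⟩ : ∃ g' : G, l⁻¹ * SemidirectProduct.inl g * l = SemidirectProduct.inl g' :=
      ⟨(l⁻¹ * SemidirectProduct.inl g * l).left, by ext <;> simp⟩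
    have h : l⁻¹ * SemidirectProduct.inl g = SemidirectProduct.inl g' * l⁻¹ := by
      rw [← hg', mul_inv_cancel_right]
    rw [← σ.map_mul_apply, h, σ.map_mul_apply, φ.invariant]

theorem InvState.act_apply (l : G ⋊[ρ] F) (φ : InvState σ) (a : A) :
    (φ.act l).functional a = φ.functional (σ l⁻¹ a) := rfl

theorem InvState.act_one (φ : InvState σ) : φ.act 1 = φ := by
  ext a
  rw [act_apply, inv_one, σ.map_one_apply]

/-- The subgroup `F_φ = {h ∈ F | φ ∘ σ(j₂(h)) = φ}` of `F`. -/
def InvState.stabilizer (φ : InvState σ) : Subgroup F where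
  carrier := {h | ∀ a, φ.functional (σ (SemidirectProduct.inr h) a) = φ.functional a}
  one_mem' a := by rw [map_one, σ.map_one_apply]
  mul_mem' {h k} hh hk a := by rw [map_mul, σ.map_mul_apply, hh, hk]
  inv_mem' {h} hh a := by rw [← hh, map_inv, σ.self_inv_apply]

/-- The closed subgroup `S_φ = G ⋊ F_φ` of `G ⋊ F`. -/
def InvState.S (φ : InvState σ) : Subgroup (G ⋊[ρ] F) :=
  φ.stabilizer.comap SemidirectProduct.rightHom

theorem InvState.mem_S_iff (φ : InvState σ) (x : G ⋊[ρ] F) :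
    x ∈ φ.S ↔ ∀ a, φ.functional (σ x a) = φ.functional a := by
  have h : ∀ a, φ.functional (σ x a) = φ.functional (σ (SemidirectProduct.inr x.right) a) := by
    intro a
    conv_lhs => rw [← SemidirectProduct.inl_left_mul_inr_right x]
    rw [σ.map_mul_apply, φ.invariant]
  simp_rw [h]
  rfl

theorem InvState.isClosed_S (φ : InvState σ) : IsClosed (φ.S : Set (G ⋊[ρ] F)) := by
  have h : (φ.S : Set (G ⋊[ρ] F)) = ⋂ a, {x | φ.functional (σ x a) = φ.functional a} := by
    ext x
    simp only [SetLike.mem_coe, φ.mem_S_iff, Set.mem_iInter, Set.mem_ofPred_eq]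
  rw [h]
  exact isClosed_iInter fun a =>
    isClosed_eq (φ.functional.continuous.comp (σ.continuous_apply a)) continuous_const

instance (φ : InvState σ) : LocallyCompactSpace φ.S :=
  φ.isClosed_S.isClosedEmbedding_subtypeVal.locallyCompactSpace

/-- The dynamical system obtained by restricting the action to `S_φ`. -/
def InvState.system (φ : InvState σ) : DynSystem φ.S A where
  toHom := σ.toHom.comp φ.S.subtype
  continuous_apply a := (σ.continuous_apply a).comp continuous_subtype_val

theorem InvState.system_apply (φ : InvState σ) (s : φ.S) (a : A) :
    φ.system s a = σ (s : G ⋊[ρ] F) a := rfl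

theorem InvState.system_invariant (φ : InvState σ) (s : φ.S) (a : A) :
    φ.functional (φ.system s a) = φ.functional a :=
  (φ.mem_S_iff s).1 s.2 a

theorem InvState.conj_mem {φ ψ : InvState σ} {l : G ⋊[ρ] F} (h : ψ = φ.act l) {x : G ⋊[ρ] F}
    (hx : x ∈ φ.S) : l * x * l⁻¹ ∈ ψ.S := by
  subst h
  rw [mem_S_iff] at hx ⊢
  intro a
  rw [act_apply, act_apply, ← σ.map_mul_apply, ← mul_assoc, ← mul_assoc, inv_mul_cancel, one_mul,
    σ.map_mul_apply, hx]

theorem InvState.eq_act_inv {φ ψ : InvState σ} {l : G ⋊[ρ] F} (h : ψ = φ.act l) :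
    φ = ψ.act l⁻¹ := by
  subst h
  ext a
  rw [act_apply, act_apply, inv_inv, σ.inv_apply_self]

theorem InvState.conj_mem_inv {φ ψ : InvState σ} {l : G ⋊[ρ] F} (h : ψ = φ.act l)
    {y : G ⋊[ρ] F} (hy : y ∈ ψ.S) : l⁻¹ * y * l ∈ φ.S := by
  have := conj_mem (eq_act_inv h) hy
  rwa [inv_inv] at this

/-- For `ψ = σ^*(l)(φ)`, the isomorphism of topological groups `ad(l) : S_φ → S_ψ`,
`x ↦ l x l⁻¹`. -/
def InvState.adEquiv {φ ψ : InvState σ} (l : G ⋊[ρ] F) (h : ψ = φ.act l) : φ.S ≃ₜ* ψ.S where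
  toFun x := ⟨l * x * l⁻¹, conj_mem h x.2⟩
  invFun y := ⟨l⁻¹ * y * l, conj_mem_inv h y.2⟩
  left_inv x := Subtype.ext (show l⁻¹ * (l * x * l⁻¹) * l = (x : G ⋊[ρ] F) by group)
  right_inv y := Subtype.ext (show l * (l⁻¹ * y * l) * l⁻¹ = (y : G ⋊[ρ] F) by group)
  map_mul' x y := Subtype.ext
    (show l * ((x : G ⋊[ρ] F) * y) * l⁻¹ = l * x * l⁻¹ * (l * y * l⁻¹) by group)
  continuous_toFun :=
    ((continuous_const.mul continuous_subtype_val).mul continuous_const).subtype_mk _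
  continuous_invFun :=
    ((continuous_const.mul continuous_subtype_val).mul continuous_const).subtype_mk _

variable {ι : Type*} {ω : ι → InvState σ}

theorem act_eq (ω : ι → InvState σ) (α : ι) (l : G ⋊[ρ] F) :
    (ω α).act l = ((ω α).act 1).act l := by rw [InvState.act_one]

/-- A Haar system associated with the family `ω` of states: Haar measures `μ_(α,l)` on the groups
`S_{σ^*(l)(ω_α)}` such that `μ_(α,l)` is the image of `μ_(α,1)` under `ad(l)`. -/
structure HaarSystem (ω : ι → InvState σ) where
  /-- The measures. -/
  meas : ∀ (α : ι) (l : G ⋊[ρ] F), Measure ((ω α).act l).S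
  isHaarMeasure : ∀ α l, IsHaarMeasure (meas α l)
  regular : ∀ α l, (meas α l).Regular
  meas_eq : ∀ α l, meas α l = Measure.map (InvState.adEquiv l (act_eq ω α l)) (meas α 1)

namespace HaarSystem

attribute [instance] isHaarMeasure regular

variable (μ : HaarSystem ω)

/-- The crossed product `B^{ω,α,l}` of `A` by `S_{σ^*(l)(ω_α)}`, formed with the Haar measure
`μ_(α,l)`. -/
abbrev B (α : ι) (l : G ⋊[ρ] F) : Type u :=
  CrossedProduct ((ω α).act l).system (μ.meas α l)

/-- The `*`-isomorphism `σ^{(ω_α,l)}` from `B^{ω,α,1}` onto `B^{ω,α,l}`: the extension by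
continuity of `f ↦ σ(l) ∘ f ∘ ad(l⁻¹)`. -/
def iso (α : ι) (l : G ⋊[ρ] F) : μ.B α 1 ≃⋆ₐ[ℂ] μ.B α l :=
  CrossedProduct.congr (InvState.adEquiv l (act_eq ω α l)) (σ l)
    (fun s a => by
      change σ l (σ (s : G ⋊[ρ] F) a) = σ (l * (s : G ⋊[ρ] F) * l⁻¹) (σ l a)
      rw [← σ.map_mul_apply, ← σ.map_mul_apply, inv_mul_cancel_right])
    (μ.meas_eq α l)

/-- The integrated form `π ⋊ U` on `B^{ω,α,l}`, where `(K, π, Ω)` is a cyclic representation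
associated with the state `σ^*(l)(ω_α)` and `U` is the unitary representation of
`S_{σ^*(l)(ω_α)}` determined by `U(s) π(a) Ω = π(σ(s) a) Ω`. -/
def integrated {K : Type u} [NormedAddCommGroup K] [InnerProductSpace ℂ K] [CompleteSpace K]
    (α : ι) (l : G ⋊[ρ] F) (c : CyclicRep A K) (hc : c.IsAssociated ((ω α).act l).functional) :
    μ.B α l →⋆ₙₐ[ℂ] (K →L[ℂ] K) :=
  (c.covRep ((ω α).act l).system hc ((ω α).act l).system_invariant).integratedForm (μ.meas α l)

end HaarSystem

end Main

section Inner

variable {X A K : Type*} [Group X] [TopologicalSpace X] [CStarAlgebra A]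
variable [NormedAddCommGroup K] [InnerProductSpace ℂ K] [CompleteSpace K]

/-- The action `σ` is inner, implemented by the homomorphism `v` into the unitary group of `A`. -/
def DynSystem.InnerImplementedBy (σ : DynSystem X A) (v : X →* unitary A) : Prop :=
  ∀ h, σ h = ad (v h)

namespace CyclicRep

variable (c : CyclicRep A K)

theorem map_one_eq : c.π 1 = 1 := by
  ext x
  refine c.denseRange_vec.induction_on (p := fun x => c.π 1 x = x) x
    (isClosed_eq (c.π 1).continuous continuous_id) fun a => ?_
  rw [← vec_mul, one_mul]

/-- The unitary operator `π(u)`, for `u` a unitary of `A`. -/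
def mapUnitary (u : unitary A) : unitary (K →L[ℂ] K) :=
  ⟨c.π u, Unitary.mem_iff.2
    ⟨by rw [← map_star, ← map_mul, Unitary.star_mul_self_of_mem u.2, map_one_eq],
     by rw [← map_star, ← map_mul, Unitary.mul_star_self_of_mem u.2, map_one_eq]⟩⟩

/-- The cyclic representation `(K, π, π(u) Ω)`. -/
def rotate (u : unitary A) : CyclicRep A K where
  π := c.π
  Ω := c.π u c.Ω
  cyclic := by
    refine c.cyclic.mono ?_
    rintro _ ⟨a, rfl⟩
    refine ⟨a * star (u : A), ?_⟩
    have h : c.π (a * star (u : A)) (c.vec u) = c.vec a := by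
      rw [← vec_mul, mul_assoc, Unitary.coe_star_mul_self, mul_one]
    exact h

end CyclicRep

end Inner

section Associated

variable {G F A : Type u} [Group G] [TopologicalSpace G] [IsTopologicalGroup G] [T2Space G]
variable [LocallyCompactSpace G]
variable [Group F] [TopologicalSpace F] [IsTopologicalGroup F] [T2Space F] [LocallyCompactSpace F]
variable {ρ : F →* MulAut G} [IsContinuousAction ρ] [CStarAlgebra A]
variable {σ : DynSystem (G ⋊[ρ] F) A}
variable {K : Type u} [NormedAddCommGroup K] [InnerProductSpace ℂ K] [CompleteSpace K]

theorem CyclicRep.isAssociated_one {c : CyclicRep A K} {φ : InvState σ}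
    (hc : c.IsAssociated φ.functional) : c.IsAssociated (φ.act 1).functional := by
  rwa [InvState.act_one]

theorem CyclicRep.isAssociated_rotate {c : CyclicRep A K} {φ : InvState σ}
    (hc : c.IsAssociated φ.functional) {v : G ⋊[ρ] F →* unitary A}
    (hv : σ.InnerImplementedBy v) (l : G ⋊[ρ] F) :
    (c.rotate (v l)).IsAssociated (φ.act l).functional := by
  intro a
  have h1 : σ l⁻¹ a = star (v l : A) * (a * (v l : A)) := by
    rw [hv, map_inv, ← Unitary.star_eq_inv]
    simp [mul_assoc]
  rw [InvState.act_apply, h1, ← c.inner_vec hc, c.vec_mul]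
  rfl

variable {ι : Type*} {ω : ι → InvState σ} (μ : HaarSystem ω)

/-- The representation `R_{H,α}` of `B^{ω,α,1}`: the integrated form of the covariant
representation induced by the cyclic representation `H_α` associated with `ω_α`. -/
def HaarSystem.R (α : ι) (c : CyclicRep A K) (hc : c.IsAssociated (ω α).functional) :
    μ.B α 1 →⋆ₙₐ[ℂ] (K →L[ℂ] K) :=
  μ.integrated α 1 c (CyclicRep.isAssociated_one hc)

/-- The representation `R_{H,v,α,l}` of `B^{ω,α,l}`: the integrated form of the covariant
representation induced by the cyclic representation `(K, π, π(v(l)) Ω)`, which is associated with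
the state `σ^*(l)(ω_α)`. -/
def HaarSystem.Rv (α : ι) (l : G ⋊[ρ] F) {v : G ⋊[ρ] F →* unitary A}
    (hv : σ.InnerImplementedBy v) (c : CyclicRep A K)
    (hc : c.IsAssociated (ω α).functional) : μ.B α l →⋆ₙₐ[ℂ] (K →L[ℂ] K) :=
  μ.integrated α l (c.rotate (v l)) (CyclicRep.isAssociated_rotate hc hv l)

end Associated

end CrossedProducts

end

open CrossedProducts

/-!
Write `V = π(v(l))`. Since `σ(l) = ad(v(l))`, the unitary `V` satisfies
`π(σ(l) a) V = V π(a)`, and it carries the unitary representation attached to the cyclic vector `Ω`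
into the one attached to `V Ω`: the operators `W'(l s l⁻¹) V` and `V W(s)` agree on the dense set
of vectors `π(a) Ω`, because both send `π(a) Ω` to `π(v(l) (σ(s) a)) Ω`
(`CyclicRep.W_rotate_mul`). Hence the covariant representation of `S_{σ^*(l)(ω)}` attached to
`V Ω`, pulled back along `ad(l)` and `σ(l)`, is the conjugate by `V` of the covariant
representation of `S_ω` attached to `Ω`.

The theorem is then the naturality of the integrated form with respect to these two operations:
composing it with the isomorphism of crossed products induced by `(ad(l), σ(l))` gives the
integrated form of the pulled back representation (`CovRep.integratedForm_congr`), and conjugating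
a covariant representation by a unitary conjugates its integrated form
(`CovRep.integratedForm_conj`). Both hold on `C_c`, and extend by density.
-/

namespace CrossedProducts

section IntegratedForm

variable {X A K : Type*} [Group X] [TopologicalSpace X] [NonUnitalCStarAlgebra A]
variable [NormedAddCommGroup K] [InnerProductSpace ℂ K] [CompleteSpace K]
variable [IsTopologicalGroup X] [LocallyCompactSpace X] [MeasurableSpace X] [BorelSpace X]
variable {σ : DynSystem X A} {μ : Measure X}

theorem CovRep.integrated_conj [IsFiniteMeasureOnCompacts μ] (ρ₁ ρ₂ : CovRep σ K)
    (V : unitary (K →L[ℂ] K)) (hπ : ∀ a, ρ₁.π a * V = V * ρ₂.π a)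
    (hU : ∀ s, (ρ₁.U s : K →L[ℂ] K) * V = V * (ρ₂.U s : K →L[ℂ] K)) (f : CcAlg σ μ) :
    ρ₁.integrated f = ad V (ρ₂.integrated f) := by
  have h : ρ₁.integrated f * V = V * ρ₂.integrated f := by
    ext x
    change ρ₁.integrated f ((V : K →L[ℂ] K) x) = (V : K →L[ℂ] K) (ρ₂.integrated f x)
    rw [integrated_apply, integrated_apply,
      ← (V : K →L[ℂ] K).integral_comp_comm (ρ₂.integrable_integrand f x)]
    congr 1
    funext s
    have h1 := congrArg (fun T : K →L[ℂ] K => T x) (hU s)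
    have h2 := congrArg (fun T : K →L[ℂ] K => T ((ρ₂.U s : K →L[ℂ] K) x)) (hπ (f s))
    simp only [mul_apply_eq_comp] at h1 h2
    rw [h1, h2]
  rw [Unitary.conjStarAlgAut_apply, ← h, mul_assoc, Unitary.mul_star_self_of_mem V.2, mul_one]

end IntegratedForm

section Naturality

open CrossedProduct

variable {X Y A K : Type u} [NonUnitalCStarAlgebra A]
variable [NormedAddCommGroup K] [InnerProductSpace ℂ K] [CompleteSpace K]
variable [Group X] [TopologicalSpace X] [IsTopologicalGroup X] [LocallyCompactSpace X]
variable [MeasurableSpace X] [BorelSpace X]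
variable [Group Y] [TopologicalSpace Y] [IsTopologicalGroup Y] [LocallyCompactSpace Y]
variable [MeasurableSpace Y] [BorelSpace Y]
variable {σ : DynSystem X A} {τ : DynSystem Y A} {μ : Measure X} {ν : Measure Y}
variable [IsHaarMeasure μ] [μ.Regular] [IsHaarMeasure ν] [ν.Regular]

theorem CovRep.continuous_integratedForm (ρ : CovRep σ K) : Continuous (ρ.integratedForm μ) :=
  (LinearMap.extendOfNorm _ _).continuous

theorem CovRep.integratedForm_conj (ρ₁ ρ₂ : CovRep σ K) (V : unitary (K →L[ℂ] K))
    (hπ : ∀ a, ρ₁.π a * V = V * ρ₂.π a)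
    (hU : ∀ s, (ρ₁.U s : K →L[ℂ] K) * V = V * (ρ₂.U s : K →L[ℂ] K)) (x : CrossedProduct σ μ) :
    ρ₁.integratedForm μ x = ad V (ρ₂.integratedForm μ x) := by
  refine induction (p := fun x => ρ₁.integratedForm μ x = ad V (ρ₂.integratedForm μ x))
    (isClosed_eq ρ₁.continuous_integratedForm
      ((aut_continuous (ad V)).comp ρ₂.continuous_integratedForm)) (fun f => ?_) x
  rw [integratedForm_of, integratedForm_of, integrated_conj ρ₁ ρ₂ V hπ hU]

theorem CovRep.integratedForm_congr (e : X ≃ₜ* Y) (θ : A ≃⋆ₐ[ℂ] A)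
    (hθ : ∀ x a, θ (σ x a) = τ (e x) (θ a)) (hν : ν = Measure.map e μ) (ρ : CovRep τ K)
    (x : CrossedProduct σ μ) :
    ρ.integratedForm ν (congr e θ hθ hν x) = (ρ.pullback e θ hθ).integratedForm μ x := by
  refine induction (p := fun x => ρ.integratedForm ν (congr e θ hθ hν x) =
      (ρ.pullback e θ hθ).integratedForm μ x)
    (isClosed_eq (ρ.continuous_integratedForm.comp (ContinuousLinearMap.continuous _))
      (CovRep.continuous_integratedForm _)) (fun f => ?_) x
  rw [congr_of, integratedForm_of, integratedForm_of, integrated_transport e θ hθ hν]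

end Naturality

section Rotate

variable {X Y A K : Type*} [Group X] [TopologicalSpace X] [Group Y] [TopologicalSpace Y]
variable [CStarAlgebra A] [NormedAddCommGroup K] [InnerProductSpace ℂ K] [CompleteSpace K]
variable {σ : DynSystem X A} {τ : DynSystem Y A} {φ ψ : A →L[ℂ] ℂ}

namespace CyclicRep

variable (c : CyclicRep A K)

theorem map_ad_mul (u : unitary A) (a : A) : c.π (ad u a) * c.π u = c.π u * c.π a := by
  rw [← map_mul, ← map_mul, Unitary.conjStarAlgAut_apply, mul_assoc, Unitary.coe_star_mul_self,
    mul_one]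

theorem rotate_vec (u : unitary A) (a : A) : (c.rotate u).vec a = c.vec (a * u) :=
  (c.vec_mul a u).symm

/-- The operator `π(u)` intertwines the unitary representations attached to the cyclic vectors `Ω`
and `π(u) Ω`, when `ad(u)` intertwines the automorphisms `σ(s)` and `τ(t)`. -/
theorem W_rotate_mul (hc : c.IsAssociated φ) (hφ : ∀ s a, φ (σ s a) = φ a) (u : unitary A)
    (hc' : (c.rotate u).IsAssociated ψ) (hψ : ∀ t a, ψ (τ t a) = ψ a) {s : X} {t : Y}
    (h : ∀ a, ad u (σ s a) = τ t (ad u a)) :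
    (c.rotate u).W τ t * c.π u = c.π u * c.W σ s := by
  ext x
  change (c.rotate u).W τ t (c.π u x) = c.π u (c.W σ s x)
  refine c.denseRange_vec.induction_on
    (p := fun x => (c.rotate u).W τ t (c.π u x) = c.π u (c.W σ s x)) x
    (isClosed_eq (((c.rotate u).W τ t).continuous.comp (c.π u).continuous)
      ((c.π u).continuous.comp (c.W σ s).continuous)) fun a => ?_
  have h1 : ∀ b, c.π u (c.vec b) = (c.rotate u).vec (ad u b) := fun b => by
    rw [rotate_vec, ← vec_mul, Unitary.conjStarAlgAut_apply, mul_assoc, Unitary.coe_star_mul_self,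
      mul_one]
  rw [h1, W_vec _ _ hc' hψ, W_vec _ _ hc hφ, h1, h]

end CyclicRep

end Rotate

end CrossedProducts

theorem mainTheorem8 {G F A : Type u}
    [Group G] [TopologicalSpace G] [IsTopologicalGroup G] [T2Space G] [LocallyCompactSpace G]
    [Group F] [TopologicalSpace F] [IsTopologicalGroup F] [T2Space F] [LocallyCompactSpace F]
    (ρ : F →* MulAut G) [IsContinuousAction ρ] [CStarAlgebra A]
    (σ : DynSystem (G ⋊[ρ] F) A) (v : G ⋊[ρ] F →* unitary A) (hv : σ.InnerImplementedBy v)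
    {ι : Type*} (ω : ι → InvState σ) (μ : HaarSystem ω)
    (K : ι → Type u) [∀ α, NormedAddCommGroup (K α)] [∀ α, InnerProductSpace ℂ (K α)]
    [∀ α, CompleteSpace (K α)] (c : ∀ α, CyclicRep A (K α))
    (hc : ∀ α, (c α).IsAssociated (ω α).functional) (α : ι) (l : G ⋊[ρ] F) :
    μ.Rv α l hv (c α) (hc α) ∘ μ.iso α l =
      ad ((c α).mapUnitary (v l)) ∘ μ.R α (c α) (hc α) := by
  funext x
  -- `(ad(l), σ(l))` is an equivariant pair: `σ(l) σ(s) = σ(l s l⁻¹) σ(l)`.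
  have hθ : ∀ (s : ((ω α).act 1).S) (a : A), σ l (((ω α).act 1).system s a) =
      ((ω α).act l).system (InvState.adEquiv l (act_eq ω α l) s) (σ l a) := fun s a => by
    change σ l (σ (s : G ⋊[ρ] F) a) = σ (l * (s : G ⋊[ρ] F) * l⁻¹) (σ l a)
    rw [← σ.map_mul_apply, ← σ.map_mul_apply, inv_mul_cancel_right]
  refine (CovRep.integratedForm_congr _ (σ l) hθ (μ.meas_eq α l) _ x).trans ?_
  refine CovRep.integratedForm_conj _ _ ((c α).mapUnitary (v l)) (fun a => ?_) (fun s => ?_) x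
  · change (c α).π (σ l a) * (c α).π (v l) = (c α).π (v l) * (c α).π a
    rw [hv, CyclicRep.map_ad_mul]
  · refine (c α).W_rotate_mul (CyclicRep.isAssociated_one (hc α))
      ((ω α).act 1).system_invariant (v l) (CyclicRep.isAssociated_rotate (hc α) hv l)
      ((ω α).act l).system_invariant fun a => ?_
    rw [← hv]
    exact hθ s a
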